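/- **Theorem.** Let $\mathbb K$ be one of the normed division algebras $\mathbb R,\mathbb C,\mathbb H,\mathbb O$, of real dimension $n=1,2,4,8$, with conjugation $a\mapsto a^*$ and real part $\mathrm{Re}$. For a $2\times2$ matrix $A$ put $\tilde A=A-(\operatorname{tr}A)1$, and let $$\mathcal V=\left\{\begin{pmatrix} a&\tilde A\\ A&-a\end{pmatrix}: a\in\mathbb R,\ A\in\mathfrak h_2(\mathbb K)\right\},\qquad h(\mathcal A,\mathcal B)=\tfrac14\mathrm{Re}\operatorname{tr}(\mathcal A\mathcal B),$$ where $\mathfrak h_2(\mathbb K)$ is the space of hermitian $2\times 2$ matrices over $\mathbb K$. Then $(\mathcal V,h)$ is a Minkowski spacetime of dimension $n+3=4,5,7,11$ and signature $(n+2,1)$. Let $\mathcal S=\mathbb K^4$, let $\Gamma(\mathcal A)\Psi=\mathcal A\Psi$ for $\mathcal A\in\mathcal V$, $\Psi\in\mathcal S$, let $\langle\Psi,\Phi\rangle=\mathrm{Re}(\Psi^\dagger\Gamma^0\Phi)$ with $\Gamma^0=\begin{pmatrix}0&-1\\1&0\end{pmatrix}$, and let $\Psi\cdot\Phi\in\mathcal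 V$ be the vector with $h(\Psi\cdot\Phi,\mathcal A)=\langle\Psi,\Gamma(\mathcal A)\Phi\rangle$ for all $\mathcal A\in\mathcal V$. Let $\mathcal T=\mathcal V\oplus\mathcal S$ be the supertranslation algebra, with even part $\mathcal V$, odd part $\mathcal S$, and only nonzero bracket $[\Psi,\Phi]=\Psi\cdot\Phi$. The Lorentz algebra $\mathfrak{so}(n+2,1)$ of $h$-skew-adjoint endomorphisms of $\mathcal V$ acts on $\mathcal V$, and on $\mathcal S$ by the spinor representation $X\mapsto\frac14\sum_i\Gamma(Xe_i)\Gamma(e^i)$, where $(e_i)$ is a basis of $\mathcal V$ and $(e^i)$ its $h$-dual basis. Let $\mathfrak{siso}(n+2,1)=\mathfrak{so}(n+2,1)\ltimes\mathcal T$. Let $\beta$ be the super-skew-symmetric 4-linear form on $\mathcal T$ that vanishes on homogeneous arguments unless exactly two of them are vectors and two are spinors, and has $$\beta(\Psi,\Phi,\mathcal A,\mathcal B)=\langle\Psi,(\Gamma(\mathcal A)\Gamma(\mathcal B)-\Gamma(\mathcal B)\Gamma(\mathcal A))\Phi\rangle ,$$ and extend it to $\mathfrak{siso}(n+2,1)$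 so that it vanishes whenever one argument lies in $\mathfrak{so}(n+2,1)$. Then $\mathfrak{siso}(n+2,1)$ is a Lie superalgebra, and $\beta$ is an even 4-cocycle on it with values in the trivial representation $\mathbb R$ (in the Chevalley–Eilenberg complex of Lie superalgebras) which is nontrivial, i.e. not a coboundary. Moreover, the bigraded space with $\mathfrak{siso}(n+2,1)$ in degree $0$ and $\mathbb R$ (of even parity) in degree $2$, with $l_2$ the bracket of $\mathfrak{siso}(n+2,1)$ (zero if an argument is in $\mathbb R$), $l_4=\beta$ (zero if an argument is in $\mathbb R$) and all other brackets $l_k$ zero, is a Lie 3-superalgebra, i.e. an $L_\infty$-superalgebra with nonzero terms only in degrees $0,1,2$. It is called the 2-brane Lie 3-superalgebra $\text{2-}\mathfrak{brane}(n+2,1)$. It is nonexact, where a Lie 3-superalgebra is called exact if only its terms $V_0$ and $V_2$ are nonzero, $d=l_1=0$, and its 4-cocycle $l_4$ on $V_0$ with values in $V_2$ is a coboundary. Finally, it is an extension of $\mathfrak{siso}(n+2,1)$: there is a short exact sequence of $L_\infty$-superalgebras $$0\to b^2\mathbb R\to\text{2-}\mathfrak{brane}(n+2,1)\to\mathfrak{siso}(n+2,1)\to0$$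 given by the inclusion and the projection, where $b^2\mathbb R$ is the abelian $L_\infty$-superalgebra with $\mathbb R$ in degree $2$. -/

import Mathlib

open scoped Quaternion Matrix

noncomputable section

namespace Brane

/-! ## Normed division algebras -/

/-- A normed division algebra: a finite-dimensional, possibly nonassociative, unital real algebra
with a conjugation `star` whose real part `re a` is given by `a + a* = 2 re(a) 1`, such that
`|a|² = re (a a*)` is positive definite and multiplicative. -/
class NormedDivisionAlgebra (K : Type) extends NonAssocRing K, StarRing K, Module ℝ K where
  real_smul_mul : ∀ (r : ℝ) (a b : K), (r • a) * b = r • (a * b)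
  mul_real_smul : ∀ (r : ℝ) (a b : K), a * (r • b) = r • (a * b)
  finite : Module.Finite ℝ K
  re : K →ₗ[ℝ] ℝ
  re_one : re 1 = 1
  add_star : ∀ a : K, a + star a = (2 * re a) • (1 : K)
  normSq_pos : ∀ a : K, a ≠ 0 → 0 < re (a * star a)
  normSq_mul : ∀ a b : K, re ((a * b) * star (a * b)) = re (a * star a) * re (b * star b)

open NormedDivisionAlgebra (re)

instance (K : Type) [NormedDivisionAlgebra K] : Module.Finite ℝ K := NormedDivisionAlgebra.finite

instance (K : Type) [NormedDivisionAlgebra K] : IsScalarTower ℝ K K :=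
  ⟨NormedDivisionAlgebra.real_smul_mul⟩

instance (K : Type) [NormedDivisionAlgebra K] : SMulCommClass ℝ K K :=
  ⟨fun r a b => (NormedDivisionAlgebra.mul_real_smul r a b).symm⟩

instance : NormedDivisionAlgebra ℝ :=
  { (inferInstance : NonAssocRing ℝ), (inferInstance : StarRing ℝ),
    (inferInstance : Module ℝ ℝ) with
    real_smul_mul := fun r a b => smul_mul_assoc r a b
    mul_real_smul := fun r a b => mul_smul_comm r a b
    finite := inferInstance
    re := LinearMap.id
    re_one := rfl
    add_star := fun a => by simp; ring
    normSq_pos := fun a ha => by simpa using mul_self_pos.mpr ha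
    normSq_mul := fun a b => by simp; ring }

instance : NormedDivisionAlgebra ℂ :=
  { (inferInstance : NonAssocRing ℂ), (inferInstance : StarRing ℂ),
    (inferInstance : Module ℝ ℂ) with
    real_smul_mul := fun r a b => smul_mul_assoc r a b
    mul_real_smul := fun r a b => mul_smul_comm r a b
    finite := inferInstance
    re := Complex.reLm
    re_one := rfl
    add_star := fun a => by
      apply Complex.ext <;> simp
      ring
    normSq_pos := fun a ha => by
      have := Complex.normSq_pos.mpr ha
      simpa [Complex.normSq_apply] using this
    normSq_mul := fun a b => by simp; ring }

/-- The real part of a quaternion, as a linear map. -/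
def quaternionRe : ℍ[ℝ] →ₗ[ℝ] ℝ where
  toFun a := a.re
  map_add' _ _ := rfl
  map_smul' _ _ := rfl

theorem quaternionRe_apply (a : ℍ[ℝ]) : quaternionRe a = a.re := rfl

instance : NormedDivisionAlgebra ℍ[ℝ] :=
  { (inferInstance : NonAssocRing ℍ[ℝ]), (inferInstance : StarRing ℍ[ℝ]),
    (inferInstance : Module ℝ ℍ[ℝ]) with
    real_smul_mul := fun r a b => smul_mul_assoc r a b
    mul_real_smul := fun r a b => mul_smul_comm r a b
    finite := inferInstance
    re := quaternionRe
    re_one := rfl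
    add_star := fun a => by
      apply QuaternionAlgebra.ext <;> simp [quaternionRe_apply]
      ring
    normSq_pos := fun a ha => by
      have h : (0 : ℝ) < Quaternion.normSq a :=
        lt_of_le_of_ne Quaternion.normSq_nonneg (Ne.symm (by simpa using ha))
      simpa [quaternionRe_apply, Quaternion.normSq_def] using h
    normSq_mul := fun a b => by
      have h := map_mul (Quaternion.normSq (R := ℝ)) a b
      simp only [Quaternion.normSq_def] at h
      exact h }

/-- The octonions, obtained from the quaternions by the Cayley--Dickson construction. -/
def Octonion : Type := ℍ[ℝ] × ℍ[ℝ]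

namespace Octonion

instance : AddCommGroup Octonion := inferInstanceAs (AddCommGroup (ℍ[ℝ] × ℍ[ℝ]))

instance : Module ℝ Octonion := inferInstanceAs (Module ℝ (ℍ[ℝ] × ℍ[ℝ]))

instance : Module.Finite ℝ Octonion := inferInstanceAs (Module.Finite ℝ (ℍ[ℝ] × ℍ[ℝ]))

instance : One Octonion := ⟨((1 : ℍ[ℝ]), (0 : ℍ[ℝ]))⟩

instance : Mul Octonion :=
  ⟨fun x y => (x.1 * y.1 - star y.2 * x.2, y.2 * x.1 + x.2 * star y.1)⟩

instance : Star Octonion := ⟨fun x => (star x.1, -x.2)⟩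

theorem ext' {x y : Octonion} (h₁ : x.1 = y.1) (h₂ : x.2 = y.2) : x = y := Prod.ext h₁ h₂

theorem mul_fst (x y : Octonion) : (x * y).1 = x.1 * y.1 - star y.2 * x.2 := rfl
theorem mul_snd (x y : Octonion) : (x * y).2 = y.2 * x.1 + x.2 * star y.1 := rfl
theorem one_fst : (1 : Octonion).1 = 1 := rfl
theorem one_snd : (1 : Octonion).2 = 0 := rfl
theorem zero_fst : (0 : Octonion).1 = 0 := rfl
theorem zero_snd : (0 : Octonion).2 = 0 := rfl
theorem add_fst (x y : Octonion) : (x + y).1 = x.1 + y.1 := rfl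
theorem add_snd (x y : Octonion) : (x + y).2 = x.2 + y.2 := rfl
theorem smul_fst (r : ℝ) (x : Octonion) : (r • x).1 = r • x.1 := rfl
theorem smul_snd (r : ℝ) (x : Octonion) : (r • x).2 = r • x.2 := rfl
theorem star_fst (x : Octonion) : (star x).1 = star x.1 := rfl
theorem star_snd (x : Octonion) : (star x).2 = -x.2 := rfl

instance : NonAssocRing Octonion :=
  { (inferInstance : AddCommGroup Octonion) with
    mul := (· * ·)
    one := 1
    left_distrib := fun x y z => by
      apply ext' <;> simp only [mul_fst, mul_snd, add_fst, add_snd, star_add] <;> noncomm_ring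
    right_distrib := fun x y z => by
      apply ext' <;> simp only [mul_fst, mul_snd, add_fst, add_snd] <;> noncomm_ring
    zero_mul := fun x => by
      apply ext' <;> simp [mul_fst, mul_snd, zero_fst, zero_snd]
    mul_zero := fun x => by
      apply ext' <;> simp [mul_fst, mul_snd, zero_fst, zero_snd]
    one_mul := fun x => by
      apply ext' <;> simp [mul_fst, mul_snd, one_fst, one_snd]
    mul_one := fun x => by
      apply ext' <;> simp [mul_fst, mul_snd, one_fst, one_snd] }

instance : StarRing Octonion where
  star_involutive x := by apply ext' <;> simp [star_fst, star_snd]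
  star_mul x y := by
    apply ext'
    · simp only [mul_fst, star_fst, star_snd, star_sub, star_mul, star_star, star_neg]
      noncomm_ring
    · simp only [mul_snd, star_fst, star_snd, star_star]
      noncomm_ring
  star_add x y := by
    apply ext' <;> simp only [add_fst, add_snd, star_fst, star_snd, star_add, neg_add]

/-- The real part of an octonion, as a linear map. -/
def reLin : Octonion →ₗ[ℝ] ℝ where
  toFun x := x.1.re
  map_add' _ _ := rfl
  map_smul' _ _ := rfl

theorem reLin_apply (x : Octonion) : reLin x = x.1.re := rfl

theorem re_mul_star (x : Octonion) :
    reLin (x * star x) = Quaternion.normSq x.1 + Quaternion.normSq x.2 := by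
  simp [reLin_apply, mul_fst, star_fst, star_snd, Quaternion.normSq_def', pow_two]

end Octonion

open Octonion in
instance : NormedDivisionAlgebra Octonion :=
  { (inferInstance : NonAssocRing Octonion), (inferInstance : StarRing Octonion),
    (inferInstance : Module ℝ Octonion) with
    real_smul_mul := fun r a b => by
      apply ext' <;> simp [mul_fst, mul_snd, smul_fst, smul_snd, smul_sub, smul_add]
    mul_real_smul := fun r a b => by
      apply ext' <;> simp [mul_fst, mul_snd, smul_fst, smul_snd, smul_sub, smul_add]
    finite := inferInstance
    re := reLin
    re_one := rfl
    add_star := fun a => by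
      apply ext'
      · apply QuaternionAlgebra.ext <;>
          simp [reLin_apply, add_fst, smul_fst, one_fst, star_fst]
        ring
      · simp [add_snd, smul_snd, one_snd, star_snd]
    normSq_pos := fun a ha => by
      have h := re_mul_star a
      refine lt_of_lt_of_eq ?_ h.symm
      by_contra hn
      have h1 : 0 ≤ Quaternion.normSq a.1 := Quaternion.normSq_nonneg
      have h2 : 0 ≤ Quaternion.normSq a.2 := Quaternion.normSq_nonneg
      exact ha (ext' (Quaternion.normSq_eq_zero.mp (by linarith))
        (Quaternion.normSq_eq_zero.mp (by linarith)))
    normSq_mul := fun a b => by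
      refine (re_mul_star (a * b)).trans ?_
      refine Eq.trans ?_ (congrArg₂ (· * ·) (re_mul_star a).symm (re_mul_star b).symm)
      simp [mul_fst, mul_snd, Quaternion.normSq_def']
      ring }

/-- Labels for the four normed division algebras. -/
inductive DivAlg
  | real
  | complex
  | quaternion
  | octonion

/-- The normed division algebra `ℝ`, `ℂ`, `ℍ` or `𝕆` with a given label. -/
@[reducible]
def DivAlg.carrier : DivAlg → Type
  | .real => ℝ
  | .complex => ℂ
  | .quaternion => ℍ[ℝ]
  | .octonion => Octonion

instance (k : DivAlg) : NormedDivisionAlgebra k.carrier :=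
  match k with
  | .real => inferInstanceAs (NormedDivisionAlgebra ℝ)
  | .complex => inferInstanceAs (NormedDivisionAlgebra ℂ)
  | .quaternion => inferInstanceAs (NormedDivisionAlgebra ℍ[ℝ])
  | .octonion => inferInstanceAs (NormedDivisionAlgebra Octonion)

/-- The real dimension `n = 1, 2, 4, 8`. -/
def DivAlg.dim : DivAlg → ℕ
  | .real => 1
  | .complex => 2
  | .quaternion => 4
  | .octonion => 8

/-! ## Vectors and spinors in dimension `n + 3` -/

section Spacetime

variable (K : Type) [NormedDivisionAlgebra K]

variable {K} in
theorem star_eq (a : K) : star a = (2 * re a) • (1 : K) - a :=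
  eq_sub_of_add_eq' (NormedDivisionAlgebra.add_star a)

variable {K} in
theorem star_smul' (r : ℝ) (a : K) : star (r • a) = r • star a := by
  rw [star_eq, star_eq, smul_sub, smul_smul, map_smul, smul_eq_mul]
  congr 2
  ring

/-- The index set of `K⁴ = K² ⊕ K²`. -/
abbrev Idx : Type := Fin 2 ⊕ Fin 2

/-- The `2 × 2` hermitian matrices `𝔥₂(K)`. -/
def herm : Submodule ℝ (Matrix (Fin 2) (Fin 2) K) where
  carrier := {A | Aᴴ = A}
  add_mem' {A B} hA hB := by
    simp only [Set.mem_ofPred_eq] at *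
    rw [Matrix.conjTranspose_add, hA, hB]
  zero_mem' := Matrix.conjTranspose_zero
  smul_mem' r A hA := by
    simp only [Set.mem_ofPred_eq] at *
    ext i j
    rw [Matrix.conjTranspose_apply, Matrix.smul_apply, star_smul', ← Matrix.conjTranspose_apply,
      hA, Matrix.smul_apply]

variable {K} in
/-- Trace reversal, `Ã = A - (tr A) 1`. -/
def traceRev (A : Matrix (Fin 2) (Fin 2) K) : Matrix (Fin 2) (Fin 2) K :=
  A - Matrix.diagonal fun _ => A.trace

variable {K} in
/-- The matrix with blocks `a, Ã; A, -a`. -/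
def vecMatrix (a : ℝ) (A : Matrix (Fin 2) (Fin 2) K) : Matrix Idx Idx K :=
  Matrix.fromBlocks (a • 1) (traceRev A) A (-(a • 1))

variable {K} in
theorem vecMatrix_add (a b : ℝ) (A B : Matrix (Fin 2) (Fin 2) K) :
    vecMatrix a A + vecMatrix b B = vecMatrix (a + b) (A + B) := by
  rw [vecMatrix, vecMatrix, vecMatrix, Matrix.fromBlocks_add]
  congr 1
  · rw [add_smul]
  · ext i j
    simp [traceRev, Matrix.diagonal_apply]
    split_ifs <;> abel
  · rw [add_smul, neg_add]

variable {K} in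
theorem vecMatrix_smul (r a : ℝ) (A : Matrix (Fin 2) (Fin 2) K) :
    r • vecMatrix a A = vecMatrix (r * a) (r • A) := by
  rw [vecMatrix, vecMatrix, Matrix.fromBlocks_smul]
  congr 1
  · rw [smul_smul]
  · ext i j
    simp [traceRev, Matrix.diagonal_apply, smul_sub]
  · rw [smul_neg, smul_smul]

/-- The vectors in `(n+3)`-dimensional Minkowski spacetime: the `4 × 4` matrices over `K` with
blocks `a, Ã; A, -a`, for `a` real and `A` hermitian. -/
def vecSubmodule : Submodule ℝ (Matrix Idx Idx K) where
  carrier := {M | ∃ a : ℝ, ∃ A ∈ herm K, M = vecMatrix a A}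
  add_mem' := by
    rintro _ _ ⟨a, A, hA, rfl⟩ ⟨b, B, hB, rfl⟩
    exact ⟨a + b, A + B, add_mem hA hB, vecMatrix_add a b A B⟩
  zero_mem' := ⟨0, 0, zero_mem _, by
    have := vecMatrix_smul (K := K) 0 0 0
    simpa using this⟩
  smul_mem' := by
    rintro r _ ⟨a, A, hA, rfl⟩
    exact ⟨r * a, r • A, Submodule.smul_mem _ r hA, vecMatrix_smul r a A⟩

instance : Module.Finite ℝ (Matrix Idx Idx K) :=
  inferInstanceAs (Module.Finite ℝ (Idx → Idx → K))

/-- The space of vectors as a type. -/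
def Vec : Type := vecSubmodule K

instance : AddCommGroup (Vec K) := inferInstanceAs (AddCommGroup (vecSubmodule K))

instance : Module ℝ (Vec K) := inferInstanceAs (Module ℝ (vecSubmodule K))

instance : Module.Finite ℝ (Vec K) := inferInstanceAs (Module.Finite ℝ (vecSubmodule K))

variable {K} in
/-- The matrix of a vector. -/
def Vec.mat (M : Vec K) : Matrix Idx Idx K := M.1

variable {K} in
/-- A vector from its matrix. -/
def Vec.mk (M : Matrix Idx Idx K) (hM : M ∈ vecSubmodule K) : Vec K := ⟨M, hM⟩

variable {K} in
theorem Vec.mat_mk (M : Matrix Idx Idx K) (hM : M ∈ vecSubmodule K) : (Vec.mk M hM).mat = M := rfl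

variable {K} in
theorem Vec.mat_mem (M : Vec K) : M.mat ∈ vecSubmodule K := M.2

variable {K} in
theorem Vec.ext {M N : Vec K} (h : M.mat = N.mat) : M = N := Subtype.ext h

variable {K} in
theorem Vec.mat_add (M N : Vec K) : (M + N).mat = M.mat + N.mat := rfl

variable {K} in
theorem Vec.mat_smul (r : ℝ) (M : Vec K) : (r • M).mat = r • M.mat := rfl

/-- The Minkowski metric `h(𝒜, ℬ) = ¼ Re tr (𝒜 ℬ)`; see `minkowski_self`. -/
def minkowski : LinearMap.BilinForm ℝ (Vec K) :=
  LinearMap.mk₂ ℝ (fun M N => (1 / 4 : ℝ) * re (Matrix.trace (M.mat * N.mat)))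
    (fun M M' N => by
      rw [Vec.mat_add, Matrix.add_mul, Matrix.trace_add, map_add, mul_add])
    (fun r M N => by
      rw [Vec.mat_smul, Matrix.smul_mul, Matrix.trace_smul, map_smul, smul_eq_mul,
        smul_eq_mul]
      ring)
    (fun M N N' => by
      rw [Vec.mat_add, Matrix.mul_add, Matrix.trace_add, map_add, mul_add])
    (fun r M N => by
      rw [Vec.mat_smul, Matrix.mul_smul, Matrix.trace_smul, map_smul, smul_eq_mul,
        smul_eq_mul]
      ring)

theorem minkowski_apply (M N : Vec K) :
    minkowski K M N = (1 / 4 : ℝ) * re (Matrix.trace (M.mat * N.mat)) := rfl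

variable {K} in
theorem herm_diag {A : Matrix (Fin 2) (Fin 2) K} (hA : A ∈ herm K) (i : Fin 2) :
    A i i = re (A i i) • (1 : K) := by
  have h : star (A i i) = A i i := congrFun (congrFun hA i) i
  have h2 := NormedDivisionAlgebra.add_star (A i i)
  rw [h, ← two_smul ℝ, mul_smul] at h2
  exact smul_right_injective K (two_ne_zero (α := ℝ)) h2

variable {K} in
theorem herm_off {A : Matrix (Fin 2) (Fin 2) K} (hA : A ∈ herm K) : A 1 0 = star (A 0 1) :=
  (congrFun (congrFun hA 1) 0).symm

variable {K} in
theorem star_mul_comm (a : K) : star a * a = a * star a := by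
  rw [star_eq, sub_mul, mul_sub, smul_mul_assoc, mul_smul_comm, one_mul, mul_one]

variable {K} in
/-- On the diagonal `h(𝒜, 𝒜) = a² + g(A, A)` with `g(A, A) = -det A`. -/
theorem minkowski_self (a : ℝ) (A : Matrix (Fin 2) (Fin 2) K) (hA : A ∈ herm K) :
    minkowski K (.mk (vecMatrix a A) ⟨a, A, hA, rfl⟩) (.mk (vecMatrix a A) ⟨a, A, hA, rfl⟩) =
      a ^ 2 - re (A 0 0 * A 1 1 - A 0 1 * A 1 0) := by
  have h0 := herm_diag hA 0
  have h1 := herm_diag hA 1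
  have h10 := herm_off hA
  have hc := star_mul_comm (A 0 1)
  have e1 : re (1 : K) = 1 := NormedDivisionAlgebra.re_one
  have hA2 : A = !![A 0 0, A 0 1; star (A 0 1), A 1 1] := by
    ext i j
    fin_cases i <;> fin_cases j <;> simp [h10]
  generalize A 0 1 = y at *
  generalize A 0 0 = p at *
  generalize A 1 1 = s at *
  generalize re p = p' at *
  generalize re s = s' at *
  subst h0 h1
  simp only [minkowski_apply, Vec.mat_mk, vecMatrix, Matrix.fromBlocks_multiply,
    Matrix.trace, Fintype.sum_sum_type, Matrix.diag, Matrix.fromBlocks_apply₁₁,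
    Matrix.fromBlocks_apply₂₂]
  rw [h10, hA2]
  simp [Matrix.mul_apply, Fin.sum_univ_two, traceRev, Matrix.trace, hc, sub_mul, mul_sub, mul_add,
    e1]
  ring

variable {K} in
theorem vec_conjTranspose {M : Matrix Idx Idx K} (hM : M ∈ vecSubmodule K) :
    Mᴴ ∈ vecSubmodule K := by
  obtain ⟨a, A, hA, rfl⟩ := hM
  have h0 := herm_diag hA 0
  have h1 := herm_diag hA 1
  have s0 : star (A 0 0) = A 0 0 := congrFun (congrFun hA 0) 0
  have s1 : star (A 1 1) = A 1 1 := congrFun (congrFun hA 1) 1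
  have hA' : Aᴴ = A := hA
  have ht : (traceRev A)ᴴ = traceRev A := by
    rw [traceRev, Matrix.conjTranspose_sub, hA', Matrix.diagonal_conjTranspose]
    congr 2
    funext i
    simp [Matrix.trace, Fin.sum_univ_two, s0, s1]
  refine ⟨a, traceRev A, ht, ?_⟩
  have hs : ((a • 1 : Matrix (Fin 2) (Fin 2) K))ᴴ = a • 1 := by
    ext i j
    rw [Matrix.conjTranspose_apply, Matrix.smul_apply, star_smul', Matrix.smul_apply,
      Matrix.one_apply, Matrix.one_apply]
    by_cases h : i = j
    · simp [h]
    · simp [h, Ne.symm h]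
  rw [vecMatrix, vecMatrix, Matrix.fromBlocks_conjTranspose, hA', ht, Matrix.conjTranspose_neg, hs]
  congr 1
  ext i j
  fin_cases i <;> fin_cases j <;> simp [traceRev, Matrix.trace, Fin.sum_univ_two, two_mul]
    <;> abel

variable {K} in
theorem normSq_nonneg (a : K) : 0 ≤ re (a * star a) := by
  by_cases h : a = 0
  · simp [h]
  · exact (NormedDivisionAlgebra.normSq_pos a h).le

variable {K} in
theorem minkowski_conj_pos (M : Vec K) (hM : M ≠ 0) :
    0 < minkowski K M (.mk M.matᴴ (vec_conjTranspose M.mat_mem)) := by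
  have hexp : minkowski K M (.mk M.matᴴ (vec_conjTranspose M.mat_mem)) =
      (1 / 4 : ℝ) * ∑ i, ∑ j, re (M.mat i j * star (M.mat i j)) := by
    simp only [minkowski_apply, Vec.mat_mk, Matrix.trace, Matrix.diag, Matrix.mul_apply,
      Matrix.conjTranspose_apply, map_sum]
  rw [hexp]
  have hne : ∃ i j, M.mat i j ≠ 0 := by
    by_contra hcon
    push Not at hcon
    exact hM (Vec.ext (Matrix.ext hcon))
  obtain ⟨i, j, hij⟩ := hne
  refine mul_pos (by norm_num) ?_
  refine Finset.sum_pos' (fun i _ => Finset.sum_nonneg fun j _ => normSq_nonneg _)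
    ⟨i, Finset.mem_univ _, ?_⟩
  exact Finset.sum_pos' (fun j _ => normSq_nonneg _)
    ⟨j, Finset.mem_univ _, NormedDivisionAlgebra.normSq_pos _ hij⟩

theorem minkowski_nondegenerate : (minkowski K).Nondegenerate := by
  refine LinearMap.BilinForm.Nondegenerate.ofSeparatingLeft fun M h => ?_
  by_contra hM
  exact (minkowski_conj_pos M hM).ne' (h _)

/-- The spinors `K⁴ = S₊ ⊕ S₋`. -/
abbrev Spinor : Type := Idx → K

/-- The Clifford action of vectors on spinors, `Γ(𝒜) Ψ = 𝒜 Ψ`. -/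
def gamma : Vec K →ₗ[ℝ] Module.End ℝ (Spinor K) :=
  LinearMap.mk₂ ℝ (fun M Ψ => M.mat *ᵥ Ψ)
    (fun M N Ψ => Matrix.add_mulVec M.mat N.mat Ψ)
    (fun r M Ψ => Matrix.smul_mulVec r M.mat Ψ)
    (fun M Ψ Φ => Matrix.mulVec_add M.mat Ψ Φ)
    (fun r M Ψ => Matrix.mulVec_smul M.mat r Ψ)

/-- The matrix `Γ⁰` with blocks `0, -1; 1, 0`. -/
def gammaZero : Matrix Idx Idx K := Matrix.fromBlocks 0 (-1) 1 0

/-- The skew-symmetric form on spinors, `⟨Ψ, Φ⟩ = Re (Ψ† Γ⁰ Φ)`. -/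
def pairing : Spinor K →ₗ[ℝ] Spinor K →ₗ[ℝ] ℝ :=
  LinearMap.mk₂ ℝ (fun Ψ Φ => re (star Ψ ⬝ᵥ (gammaZero K *ᵥ Φ)))
    (fun Ψ Ψ' Φ => by rw [star_add, add_dotProduct, map_add])
    (fun r Ψ Φ => by
      have h : star (r • Ψ) = r • star Ψ := funext fun i => star_smul' r (Ψ i)
      rw [h, smul_dotProduct, map_smul])
    (fun Ψ Φ Φ' => by rw [Matrix.mulVec_add, dotProduct_add, map_add])
    (fun r Ψ Φ => by rw [Matrix.mulVec_smul, dotProduct_smul, map_smul])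

/-- The bracket of spinors: `Ψ · Φ` is the unique vector with `h(Ψ · Φ, 𝒜) = ⟨Ψ, Γ(𝒜) Φ⟩` for all
vectors `𝒜`. -/
def dot : Spinor K →ₗ[ℝ] Spinor K →ₗ[ℝ] Vec K :=
  LinearMap.mk₂ ℝ
    (fun Ψ Φ => ((minkowski K).toDual (minkowski_nondegenerate K)).symm
      (pairing K Ψ ∘ₗ (gamma K).flip Φ))
    (fun Ψ Ψ' Φ => by rw [map_add, LinearMap.add_comp, map_add])
    (fun r Ψ Φ => by rw [map_smul, LinearMap.smul_comp, map_smul])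
    (fun Ψ Φ Φ' => by rw [map_add, LinearMap.comp_add, map_add])
    (fun r Ψ Φ => by rw [map_smul, LinearMap.comp_smul, map_smul])

theorem minkowski_dot (Ψ Φ : Spinor K) (A : Vec K) :
    minkowski K (dot K Ψ Φ) A = pairing K Ψ (gamma K A Φ) :=
  LinearMap.BilinForm.apply_toDual_symm_apply (hB := minkowski_nondegenerate K) _ _

/-- The Lorentz algebra `𝔰𝔬(n+2, 1)`: the endomorphisms of the space of vectors that are
skew-adjoint for the Minkowski metric. -/
abbrev so : Submodule ℝ (Module.End ℝ (Vec K)) := (minkowski K).skewAdjointSubmodule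

/-- The commutator on the Lorentz algebra. -/
def soBracket : so K →ₗ[ℝ] so K →ₗ[ℝ] so K :=
  LinearMap.mk₂ ℝ
    (fun X Y => ⟨⁅X.1, Y.1⁆, LinearMap.BilinForm.isSkewAdjoint_bracket (minkowski K) X.2 Y.2⟩)
    (fun X X' Y => Subtype.ext (by simp only [Submodule.coe_add, Ring.lie_def]; noncomm_ring))
    (fun r X Y => Subtype.ext (by simp [Ring.lie_def, smul_sub]))
    (fun X Y Y' => Subtype.ext (by simp only [Submodule.coe_add, Ring.lie_def]; noncomm_ring))
    (fun r X Y => Subtype.ext (by simp [Ring.lie_def, smul_sub]))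

/-- The spinor representation of the Lorentz algebra, `X ↦ ¼ ∑ Γ(X eᵢ) Γ(eⁱ)` for a basis `eᵢ` of
the vectors and its dual basis `eⁱ` for the Minkowski metric; see `spin_bivector`. -/
def spin : so K →ₗ[ℝ] Module.End ℝ (Spinor K) where
  toFun X := (1 / 4 : ℝ) • ∑ i,
    gamma K (X.1 (Module.finBasis ℝ (Vec K) i)) *
      gamma K ((minkowski K).dualBasis (minkowski_nondegenerate K)
        (Module.finBasis ℝ (Vec K)) i)
  map_add' X Y := by
    rw [← smul_add, ← Finset.sum_add_distrib]
    congr 1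
    refine Finset.sum_congr rfl fun i _ => ?_
    rw [← add_mul, ← map_add]
    rfl
  map_smul' r X := by
    rw [RingHom.id_apply, smul_comm r (1 / 4 : ℝ)]
    congr 1
    rw [Finset.smul_sum]
    apply Finset.sum_congr rfl
    intro i _
    rw [← smul_mul_assoc, ← map_smul]
    rfl

theorem spin_apply (X : so K) : spin K X = (1 / 4 : ℝ) • ∑ i,
    gamma K (X.1 (Module.finBasis ℝ (Vec K) i)) *
      gamma K ((minkowski K).dualBasis (minkowski_nondegenerate K)
        (Module.finBasis ℝ (Vec K)) i) := rfl

/-- The bivector `𝒜 ∧ ℬ` acts on vectors by `𝒞 ↦ h(ℬ, 𝒞) 𝒜 - h(𝒜, 𝒞) ℬ` and on spinors by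
`¼ (Γ(𝒜) Γ(ℬ) - Γ(ℬ) Γ(𝒜))`. -/
theorem spin_bivector (A B : Vec K) (X : so K)
    (hX : ∀ C, X.1 C = minkowski K B C • A - minkowski K A C • B) :
    spin K X = (1 / 4 : ℝ) • (gamma K A * gamma K B - gamma K B * gamma K A) := by
  have key : ∀ D : Vec K, ∑ i, minkowski K D (Module.finBasis ℝ (Vec K) i) •
      (minkowski K).dualBasis (minkowski_nondegenerate K) (Module.finBasis ℝ (Vec K)) i = D := by
    intro D
    have h := ((minkowski K).dualBasis (minkowski_nondegenerate K)
      (Module.finBasis ℝ (Vec K))).sum_repr D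
    simpa only [LinearMap.BilinForm.dualBasis_repr_apply] using h
  rw [spin_apply]
  congr 1
  have hA := congrArg (gamma K) (key A)
  have hB := congrArg (gamma K) (key B)
  rw [map_sum] at hA hB
  rw [← congrArg (gamma K A * ·) hB, ← congrArg (gamma K B * ·) hA]
  simp only [hX, map_sub, map_smul, sub_mul, Finset.mul_sum, Finset.sum_sub_distrib,
    smul_mul_assoc, mul_smul_comm]

end Spacetime

/-! ## Super vector spaces, Lie superalgebras and their cohomology

A super vector space is a real vector space `g` with a decomposition `G 0 ⊕ G 1` into an even and
an odd subspace, indexed by `ZMod 2`. -/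

/-- The sign `(-1)ᵃ`. -/
def sgn (a : ZMod 2) : ℝ := if a = 0 then 1 else -1

/-- The sign `χ(σ; x₁, …, xₙ) = sgn(σ) ε(σ; x₁, …, xₙ)`, where the Koszul sign `ε` gets the factor
`(-1)^(|x||y|)` from each pair of elements whose order is reversed in `x_σ(1) ⋯ x_σ(n)`; it depends
only on the grades `q i = |xᵢ|`. -/
def chi {n : ℕ} (σ : Equiv.Perm (Fin n)) (q : Fin n → ZMod 2) : ℝ :=
  ((Equiv.Perm.sign σ : ℤ) : ℝ) *
    ∏ a, ∏ b, if a < b ∧ σ b < σ a then sgn (q (σ a) * q (σ b)) else 1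

section Super

variable {g R : Type} [AddCommGroup g] [Module ℝ g] [AddCommGroup R] [Module ℝ R]

/-- A Lie superalgebra. -/
structure IsLieSuperalgebra (G : ZMod 2 → Submodule ℝ g) (br : g →ₗ[ℝ] g →ₗ[ℝ] g) : Prop where
  internal : DirectSum.IsInternal G
  bracket_mem : ∀ p q, ∀ x ∈ G p, ∀ y ∈ G q, br x y ∈ G (p + q)
  skew : ∀ p q, ∀ x ∈ G p, ∀ y ∈ G q, br x y = -(sgn (p * q) • br y x)
  jacobi : ∀ p q r, ∀ x ∈ G p, ∀ y ∈ G q, ∀ z ∈ G r,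
    br x (br y z) = br (br x y) z + sgn (p * q) • br y (br x z)

/-- An `n`-cochain of parity `p`: a super-skew-symmetric `n`-linear map `g × ⋯ × g → R` that shifts
the parity by `p`. -/
structure IsCochain (G : ZMod 2 → Submodule ℝ g) (S : ZMod 2 → Submodule ℝ R) (p : ZMod 2) {n : ℕ}
    (ω : MultilinearMap ℝ (fun _ : Fin n => g) R) : Prop where
  parity : ∀ (q : Fin n → ZMod 2) (x : Fin n → g), (∀ i, x i ∈ G (q i)) → ω x ∈ S (p + ∑ i, q i)
  skew : ∀ (q : Fin n → ZMod 2) (x : Fin n → g), (∀ i, x i ∈ G (q i)) →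
    ∀ σ : Equiv.Perm (Fin n), ω (fun i => x (σ i)) = chi σ q • ω x

/-- The value `dω(X₁, …, Xₙ₊₂)` of the Chevalley--Eilenberg coboundary of an `(n+1)`-cochain `ω` of
parity `p` at homogeneous elements `Xᵢ` of parity `q i`, for a bracket `br` and an action `ρ`. In
the double sum, `i < j` and `j.succAbove ∘ i.succAbove` enumerates the indices other than
`i, j` in increasing order. -/
def coboundary (br : g → g → g) (ρ : g → R → R) (p : ZMod 2) {n : ℕ}
    (ω : MultilinearMap ℝ (fun _ : Fin (n + 1) => g) R)
    (q : Fin (n + 2) → ZMod 2) (X : Fin (n + 2) → g) : R :=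
  (∑ i : Fin (n + 2), ((-1 : ℝ) ^ (i : ℕ) * sgn (q i * p) * ∏ a ∈ Finset.Iio i, sgn (q i * q a)) •
      ρ (X i) (ω fun k => X (i.succAbove k))) +
    ∑ j : Fin (n + 2), ∑ i : Fin (n + 1), if i.castSucc < j then
      ((-1 : ℝ) ^ ((i : ℕ) + (j : ℕ)) * sgn (q i.castSucc * q j) *
          (∏ a ∈ Finset.Iio i.castSucc, sgn (q i.castSucc * q a)) *
          ∏ a ∈ Finset.Iio j, sgn (q j * q a)) •
        ω (Fin.cons (br (X i.castSucc) (X j)) fun k => X (j.succAbove (i.succAbove k)))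
    else 0

/-- An even cocycle. -/
def IsEvenCocycle (G : ZMod 2 → Submodule ℝ g) (S : ZMod 2 → Submodule ℝ R)
    (br : g → g → g) (ρ : g → R → R) {n : ℕ}
    (ω : MultilinearMap ℝ (fun _ : Fin (n + 1) => g) R) : Prop :=
  IsCochain G S 0 ω ∧
    ∀ (q : Fin (n + 2) → ZMod 2) (X : Fin (n + 2) → g), (∀ i, X i ∈ G (q i)) →
      coboundary br ρ 0 ω q X = 0

/-- A coboundary: `ω = dθ` for a cochain `θ`, the sum of its even part `θ 0` and its odd part
`θ 1`. -/
def IsCoboundary (G : ZMod 2 → Submodule ℝ g) (S : ZMod 2 → Submodule ℝ R)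
    (br : g → g → g) (ρ : g → R → R) {n : ℕ}
    (ω : MultilinearMap ℝ (fun _ : Fin (n + 2) => g) R) : Prop :=
  ∃ θ : ZMod 2 → MultilinearMap ℝ (fun _ : Fin (n + 1) => g) R,
    (∀ p, IsCochain G S p (θ p)) ∧
    ∀ (q : Fin (n + 2) → ZMod 2) (X : Fin (n + 2) → g), (∀ i, X i ∈ G (q i)) →
      ω X = ∑ p, coboundary br ρ p (θ p) q X

/-- A vector space regarded as a purely even super vector space. -/
def evenGrading (R : Type) [AddCommGroup R] [Module ℝ R] : ZMod 2 → Submodule ℝ R :=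
  fun q => if q = 0 then ⊤ else ⊥

/-- A bilinear map as a multilinear map in two arguments. -/
def toMultilinear (br : g →ₗ[ℝ] g →ₗ[ℝ] g) : MultilinearMap ℝ (fun _ : Fin 2 => g) g where
  toFun x := br (x 0) (x 1)
  map_update_add' x i a b := by fin_cases i <;> simp
  map_update_smul' x i c a := by fin_cases i <;> simp

end Super

/-! ## `L_∞`-superalgebras -/

/-- The data of an `L_∞`-superalgebra on the total space `L`: the bigrading by degree and parity,
and the brackets `l k` (with `l k` the bracket of `k` arguments). -/
structure LInftyData (L : Type) [AddCommGroup L] [Module ℝ L] where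
  grading : ℤ × ZMod 2 → Submodule ℝ L
  l : (k : ℕ) → MultilinearMap ℝ (fun _ : Fin k => L) L

namespace LInftyData

/-- The overall grade: the sum of degree and parity, modulo 2. -/
def grade (d : ℤ × ZMod 2) : ZMod 2 := (d.1 : ZMod 2) + d.2

/-- `σ` is an `(i, m)`-unshuffle. -/
def IsUnshuffle {i m : ℕ} (σ : Equiv.Perm (Fin (i + m))) : Prop :=
  StrictMono (fun a : Fin i => σ (Fin.castAdd m a)) ∧
    StrictMono (fun b : Fin m => σ (Fin.natAdd i b))

variable {L L' L'' : Type} [AddCommGroup L] [Module ℝ L] [AddCommGroup L'] [Module ℝ L']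
  [AddCommGroup L''] [Module ℝ L'']

open Classical in
/-- The part of the generalized Jacobi identity in `n = i + m` arguments with inner bracket `l i`
and outer bracket `l j`, where `j = m + 1`. -/
def jacobiTerm (A : LInftyData L) (i m : ℕ) (d : Fin (i + m) → ℤ × ZMod 2)
    (x : Fin (i + m) → L) : L :=
  ∑ σ : Equiv.Perm (Fin (i + m)), if IsUnshuffle σ then
    (chi σ (fun a => grade (d a)) * (-1 : ℝ) ^ (i * m)) •
      A.l (m + 1) (Fin.cons (A.l i fun a => x (σ (Fin.castAdd m a)))
        fun b => x (σ (Fin.natAdd i b)))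
  else 0

/-- An `L_∞`-superalgebra: the total space is the direct sum of its bihomogeneous parts, which
vanish in negative degree; there is no bracket of zero arguments; `l k` has degree `k - 2` and
preserves parity; it is totally antisymmetric; and the generalized Jacobi identity holds. -/
structure IsLInftySuperalgebra (A : LInftyData L) : Prop where
  internal : DirectSum.IsInternal A.grading
  nonneg : ∀ p q, p < 0 → A.grading (p, q) = ⊥
  l_zero : A.l 0 = 0
  degree : ∀ (k : ℕ) (d : Fin k → ℤ × ZMod 2) (x : Fin k → L), (∀ a, x a ∈ A.grading (d a)) →
    A.l k x ∈ A.grading (∑ a, (d a).1 + ((k : ℤ) - 2), ∑ a, (d a).2)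
  antisymm : ∀ (k : ℕ) (d : Fin k → ℤ × ZMod 2) (x : Fin k → L), (∀ a, x a ∈ A.grading (d a)) →
    ∀ σ : Equiv.Perm (Fin k), A.l k (fun a => x (σ a)) = chi σ (fun a => grade (d a)) • A.l k x
  jacobi : ∀ (n : ℕ) (d : Fin n → ℤ × ZMod 2) (x : Fin n → L), (∀ a, x a ∈ A.grading (d a)) →
    ∑ c : Finset.HasAntidiagonal.antidiagonal n,
      A.jacobiTerm c.1.1 c.1.2 (d ∘ Fin.cast (Finset.HasAntidiagonal.mem_antidiagonal.mp c.2))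
        (x ∘ Fin.cast (Finset.HasAntidiagonal.mem_antidiagonal.mp c.2)) = 0

/-- A Lie `n`-superalgebra: an `L_∞`-superalgebra with nonzero terms only in degrees `< n`. -/
def IsLieNSuperalgebra (n : ℕ) (A : LInftyData L) : Prop :=
  A.IsLInftySuperalgebra ∧ ∀ (p : ℤ) (q : ZMod 2), (n : ℤ) ≤ p → A.grading (p, q) = ⊥

/-- A Lie `(n+1)`-superalgebra is exact if only its terms `V₀` and `Vₙ` are nonzero, `d = l 1`
vanishes, and the `(n+2)`-cocycle `l (n+2)` on the Lie superalgebra `V₀`, with values in the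
representation `Vₙ`, is a coboundary. (A multilinear map on `V₀` is the restriction of one on the
total space.) -/
def IsExact (n : ℕ) (A : LInftyData L) : Prop :=
  (∀ (p : ℤ) (q : ZMod 2), p ≠ 0 → p ≠ n → A.grading (p, q) = ⊥) ∧ A.l 1 = 0 ∧
    IsCoboundary (fun q => A.grading (0, q)) (fun q => A.grading (n, q))
      (fun x y => A.l 2 ![x, y]) (fun x y => A.l 2 ![x, y]) (A.l (n + 2))

/-- A (strict) homomorphism of `L_∞`-superalgebras. -/
def IsHom (A : LInftyData L) (B : LInftyData L') (f : L →ₗ[ℝ] L') : Prop :=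
  (∀ d, ∀ x ∈ A.grading d, f x ∈ B.grading d) ∧ ∀ k x, f (A.l k x) = B.l k fun a => f (x a)

/-- A short exact sequence `0 → A → B → C → 0` of `L_∞`-superalgebras. -/
structure IsShortExact (A : LInftyData L) (B : LInftyData L') (C : LInftyData L'')
    (f : L →ₗ[ℝ] L') (h : L' →ₗ[ℝ] L'') : Prop where
  left : A.IsLInftySuperalgebra
  middle : B.IsLInftySuperalgebra
  right : C.IsLInftySuperalgebra
  hom_left : A.IsHom B f
  hom_right : B.IsHom C h
  injective : Function.Injective f
  exact : Function.Exact f h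
  surjective : Function.Surjective h

/-- A Lie superalgebra as an `L_∞`-superalgebra concentrated in degree `0`. -/
def ofLie (G : ZMod 2 → Submodule ℝ L) (br : L →ₗ[ℝ] L →ₗ[ℝ] L) : LInftyData L where
  grading d := if d.1 = 0 then G d.2 else ⊥
  l
    | 2 => toMultilinear br
    | _ => 0

/-- The abelian `L_∞`-superalgebra `b²ℝ`, with `ℝ` in degree `2` and even parity. -/
def bTwoR : LInftyData ℝ where
  grading d := if d = (2, 0) then ⊤ else ⊥
  l _ := 0

/-- The extension of a Lie superalgebra `L` by a `4`-cochain `ω` with values in the trivial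
representation `ℝ`: the total space is `L ⊕ ℝ`, with `L` in degree `0` and `ℝ` in degree `2` and
even parity; `l 2` is the bracket of `L` (and zero on `ℝ`), `l 4` is `ω`, and all the others
vanish. -/
def extension (G : ZMod 2 → Submodule ℝ L) (br : L →ₗ[ℝ] L →ₗ[ℝ] L)
    (ω : MultilinearMap ℝ (fun _ : Fin 4 => L) ℝ) : LInftyData (L × ℝ) where
  grading d :=
    if d.1 = 0 then (G d.2).prod ⊥ else if d = (2, 0) then Submodule.prod ⊥ ⊤ else ⊥
  l
    | 2 => (LinearMap.inl ℝ L ℝ).compMultilinearMap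
        ((toMultilinear br).compLinearMap fun _ => LinearMap.fst ℝ L ℝ)
    | 4 => (LinearMap.inr ℝ L ℝ).compMultilinearMap
        (ω.compLinearMap fun _ => LinearMap.fst ℝ L ℝ)
    | _ => 0

end LInftyData

/-! ## The Poincaré superalgebra and the cocycle `β` -/

section Poincare

variable (K : Type) [NormedDivisionAlgebra K]

/-- The supertranslation algebra `T`, with even part the vectors and odd part the spinors. -/
abbrev T : Type := Vec K × Spinor K

/-- The bracket of `T`: that of two spinors is `Ψ · Φ`, all others vanish. -/
def tBracket : T K →ₗ[ℝ] T K →ₗ[ℝ] T K :=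
  ((dot K).compl₁₂ (LinearMap.snd ℝ (Vec K) (Spinor K)) (LinearMap.snd ℝ (Vec K) (Spinor K))).compr₂
    (LinearMap.inl ℝ (Vec K) (Spinor K))

/-- The action of the Lorentz algebra on `T`. -/
def soAction : so K →ₗ[ℝ] T K →ₗ[ℝ] T K :=
  LinearMap.mk₂ ℝ (fun X t => (X.1 t.1, spin K X t.2))
    (fun X Y t => by simp)
    (fun r X t => by simp)
    (fun X t s => by simp)
    (fun r X t => by simp)

/-- The underlying space of the Poincaré superalgebra `𝔰𝔦𝔰𝔬(n+2, 1) = 𝔰𝔬(n+2, 1) ⋉ T`. -/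
abbrev Siso : Type := so K × T K

/-- The even part is `𝔰𝔬(n+2, 1) ⊕ V`, the odd part consists of the spinors. -/
def sisoGrading : ZMod 2 → Submodule ℝ (Siso K) :=
  fun q => if q = 0 then Submodule.prod ⊤ (Submodule.prod ⊤ ⊥)
    else Submodule.prod ⊥ (Submodule.prod ⊥ ⊤)

/-- The bracket of the semidirect product,
`[(X, t), (Y, s)] = ([X, Y], X s - Y t + [t, s])`. -/
def sisoBracket : Siso K →ₗ[ℝ] Siso K →ₗ[ℝ] Siso K :=
  LinearMap.mk₂ ℝ
    (fun x y => (soBracket K x.1 y.1,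
      soAction K x.1 y.2 - soAction K y.1 x.2 + tBracket K x.2 y.2))
    (fun x x' y => by ext1 <;> simp only [Prod.fst_add, Prod.snd_add, map_add,
      LinearMap.add_apply]; abel)
    (fun r x y => by ext1 <;> simp only [Prod.smul_fst, Prod.smul_snd, map_smul,
      LinearMap.smul_apply, smul_add, smul_sub])
    (fun x y y' => by ext1 <;> simp only [Prod.fst_add, Prod.snd_add, map_add,
      LinearMap.add_apply]; abel)
    (fun r x y => by ext1 <;> simp only [Prod.smul_fst, Prod.smul_snd, map_smul,
      LinearMap.smul_apply, smul_add, smul_sub])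

/-- The map `(t₀, t₁, t₂, t₃) ↦ ⟨Ψ₀, (𝒜₂ 𝒜₃ - 𝒜₃ 𝒜₂) Ψ₁⟩`, where `tᵢ = (𝒜ᵢ, Ψᵢ)` and the
commutator is that of the Clifford action. -/
def betaAux : MultilinearMap ℝ (fun _ : Fin 4 => T K) ℝ where
  toFun t := pairing K (t 0).2
    ((gamma K (t 2).1 * gamma K (t 3).1 - gamma K (t 3).1 * gamma K (t 2).1) (t 1).2)
  map_update_add' {inst} t i a b := by
    obtain rfl : inst = instDecidableEqFin 4 := Subsingleton.elim _ _
    fin_cases i <;> simp [add_mul, mul_add] <;> ring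
  map_update_smul' {inst} t i c a := by
    obtain rfl : inst = instDecidableEqFin 4 := Subsingleton.elim _ _
    fin_cases i <;> simp <;> ring

open Classical in
/-- The `(2,2)`-form `β` on `T` with `β(Ψ, Φ, 𝒜, ℬ) = ⟨Ψ, (𝒜 ℬ - ℬ 𝒜) Φ⟩`, extended to arguments in
any order by super-skew-symmetry: the sum over the `(2,2)`-unshuffles `σ` of
`sgn(σ) ⟨Ψ_σ(0), [𝒜_σ(2), 𝒜_σ(3)] Ψ_σ(1)⟩`. -/
def beta : MultilinearMap ℝ (fun _ : Fin 4 => T K) ℝ :=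
  ∑ σ : Equiv.Perm (Fin 4), if LInftyData.IsUnshuffle (i := 2) (m := 2) σ then
    ((Equiv.Perm.sign σ : ℤ) : ℝ) • (betaAux K).domDomCongr σ else 0

theorem unshuffle_aux : ∀ σ : Equiv.Perm (Fin 4),
    (σ 0 < σ 1 ∧ σ 2 < σ 3) → σ ≠ 1 → (σ 0 = 2 ∨ σ 0 = 3 ∨ σ 1 = 2 ∨ σ 1 = 3) := by
  decide

theorem beta_apply (Ψ Φ : Spinor K) (A B : Vec K) :
    beta K ![(0, Ψ), (0, Φ), (A, 0), (B, 0)] =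
      pairing K Ψ ((gamma K A * gamma K B - gamma K B * gamma K A) Φ) := by
  classical
  rw [beta, _root_.sum_apply, Finset.sum_eq_single 1]
  · rw [if_pos ⟨fun a b h => h, fun a b h => Nat.add_lt_add_left h 2⟩]
    simp [betaAux]
  · intro σ _ hσ
    split_ifs with h
    · have h1 : σ 0 < σ 1 := h.1 (show (0 : Fin 2) < 1 by decide)
      have h2 : σ 2 < σ 3 := h.2 (show (0 : Fin 2) < 1 by decide)
      rcases unshuffle_aux σ ⟨h1, h2⟩ hσ with h | h | h | h <;> simp [betaAux, h]
    · rfl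
  · intro h
    exact absurd (Finset.mem_univ _) h

/-- The extension of `β` to the Poincaré superalgebra that vanishes on `𝔰𝔬(n+2, 1)`. -/
def betaSiso : MultilinearMap ℝ (fun _ : Fin 4 => Siso K) ℝ :=
  (beta K).compLinearMap fun _ => LinearMap.snd ℝ (so K) (T K)

/-- The 2-brane Lie 3-superalgebra `2-brane(n+2, 1)`. -/
def twoBrane : LInftyData (Siso K × ℝ) :=
  LInftyData.extension (sisoGrading K) (sisoBracket K) (betaSiso K)

end Poincare

end Brane

end

open Brane

namespace Brane

/-! ## Composition algebra identities -/

section Composition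

variable {K : Type} [NormedDivisionAlgebra K]

/-! Everything except the dimension count holds for an abstract normed division algebra `K`.
Polarizing the multiplicativity of the norm twice gives `ip_exchange`, the substitute for
associativity: from it come the adjoints of multiplications, the cancellation laws `star a * (a * b)
= ip a a • b`, and the Moufang identity. The cancellation laws already make every vector square to a
scalar (`gamma_sq`). Since endomorphisms of the spinors compose associatively even when `K` does
not, the usual Clifford calculus then applies: the spin action is a Lie algebra representation, and
`gamma`, `pairing` and `dot` are equivariant (`spin_gamma`, `spin_bracket`, `pairing_spin`,
`so_dot`). This is all that the super Jacobi identity needs, because vectors commute with spinors.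

The cocycle condition splits by the parities of the five arguments. With three even and two odd
arguments it is the Lorentz invariance of β. With one even and four odd arguments it is an identity
symmetric in four spinors, hence the polarization of ⟨Ψ, [Γ(Ψ·Ψ), Γ(𝒜)] Ψ⟩ = 0. That is
`pairing_gamma_dot_self`, the only place where the Moufang identity is used. All other parities give
zero term by term.

With trivial coefficients every term of a coboundary contains the bracket of two arguments, so
coboundaries vanish on pairwise commuting elements; β takes the value -2 on such a quadruple.

In the extension the brackets ignore ℝ, so the only Jacobi terms left are `l 2` inside `l 2`, the
super Jacobi identity, and `l 2` inside `l 4`, which is dβ up to sign. A cochain exhibiting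
exactness restricts to one exhibiting β as a coboundary. -/

theorem re_star (a : K) : NormedDivisionAlgebra.re (star a) = NormedDivisionAlgebra.re a := by
  have h := congrArg NormedDivisionAlgebra.re (NormedDivisionAlgebra.add_star a)
  rw [map_add, map_smul, NormedDivisionAlgebra.re_one, smul_eq_mul, mul_one] at h
  linarith

/-- The inner product `Re (a b*)` on a normed division algebra. -/
noncomputable def ip : K →ₗ[ℝ] K →ₗ[ℝ] ℝ :=
  LinearMap.mk₂ ℝ (fun a b => NormedDivisionAlgebra.re (a * star b))
    (fun a a' b => by rw [add_mul, map_add])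
    (fun r a b => by rw [smul_mul_assoc, map_smul])
    (fun a b b' => by rw [star_add, mul_add, map_add])
    (fun r a b => by rw [star_smul', mul_smul_comm, map_smul])

theorem ip_apply (a b : K) : ip a b = NormedDivisionAlgebra.re (a * star b) := rfl

theorem ip_comm (a b : K) : ip a b = ip b a := by
  rw [ip_apply, ip_apply, ← re_star, star_mul, star_star]

theorem ip_one_right (a : K) : ip a 1 = NormedDivisionAlgebra.re a := by
  rw [ip_apply, star_one, mul_one]

theorem ip_self_pos {a : K} (ha : a ≠ 0) : 0 < ip a a := NormedDivisionAlgebra.normSq_pos a ha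

theorem ip_mul_self (a b : K) : ip (a * b) (a * b) = ip a a * ip b b :=
  NormedDivisionAlgebra.normSq_mul a b

theorem ext_ip {a b : K} (h : ∀ c, ip a c = ip b c) : a = b := by
  by_contra hne
  have := ip_self_pos (sub_ne_zero.mpr hne)
  rw [LinearMap.map_sub₂, h, sub_self] at this
  exact this.ne' rfl

/-- Polarization of the multiplicativity of the norm in the right factor. -/
theorem ip_mul_left_cancel (a b c : K) : ip (a * b) (a * c) = ip a a * ip b c := by
  have h := ip_mul_self a (b + c)
  simp only [mul_add, map_add, LinearMap.add_apply, ip_mul_self] at h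
  have h1 := ip_comm (a * b) (a * c)
  have h2 := ip_comm b c
  linear_combination (1 / 2) * h + (1 / 2) * h1 - (1 / 2) * ip a a * h2

/-- Second polarization, now in the left factor. Adjoints and the Moufang identity are both read off
from this law by specializing its entries. -/
theorem ip_exchange (a b c d : K) :
    ip (a * b) (c * d) + ip (a * d) (c * b) = 2 * ip a c * ip b d := by
  have h := ip_mul_left_cancel (a + c) b d
  simp only [add_mul, map_add, LinearMap.add_apply, ip_mul_left_cancel] at h
  have h1 := ip_comm (c * b) (a * d)
  have h2 := ip_comm a c
  linear_combination h - h1 - ip b d * h2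

/-- The exchange law with a factor `1`, combined with `star a = 2 Re(a) - a`. -/
theorem ip_mul_left (a b c : K) : ip (a * b) c = ip b (star a * c) := by
  have h := ip_exchange a b 1 c
  rw [one_mul, one_mul, ip_one_right] at h
  rw [star_eq, sub_mul, smul_mul_assoc, one_mul, map_sub, map_smul, smul_eq_mul, ip_comm b (a * c)]
  linear_combination h

theorem ip_mul_right (a b c : K) : ip (a * b) c = ip a (c * star b) := by
  have h := ip_exchange a b c 1
  rw [mul_one, mul_one, ip_one_right] at h
  rw [star_eq b, mul_sub, mul_smul_comm, mul_one, map_sub, map_smul, smul_eq_mul]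
  linear_combination h

theorem ip_star_star (a b : K) : ip (star a) (star b) = ip a b := by
  have h := ip_mul_left a 1 b
  rw [mul_one, ip_comm 1, ip_one_right] at h
  rw [h, ip_apply, star_star]

theorem re_mul (a b : K) : NormedDivisionAlgebra.re (a * b) = ip (star a) b := by
  rw [← star_star b, ← ip_apply, ip_star_star, ← ip_star_star, star_star]

/-- Multiplication by `a` scales the inner product by `ip a a`, so composing it with its adjoint is
a scalar. Nondegeneracy turns this into an identity in `K`, the part of associativity that survives
in the octonions. -/
theorem star_mul_cancel (a b : K) : star a * (a * b) = ip a a • b :=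
  ext_ip fun c => by
    rw [ip_comm, ← ip_mul_left, ip_mul_left_cancel, map_smul, LinearMap.smul_apply, smul_eq_mul,
      ip_comm b]

theorem mul_star_cancel (a b : K) : a * (star a * b) = ip a a • b := by
  have h := star_mul_cancel (star a) b
  rwa [star_star, ip_star_star] at h

theorem mul_mul_star (a b : K) : (b * a) * star a = ip a a • b := by
  have h := congrArg star (mul_star_cancel a (star b))
  rwa [star_mul, star_mul, star_star, star_star, star_smul', star_star] at h

theorem mul_star_mul (a b : K) : (b * star a) * a = ip a a • b := by
  have h := mul_mul_star (star a) b
  rwa [star_star, ip_star_star] at h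

/-- A form of the middle Moufang identity `(x y) (z x) = (x (y z)) x`. -/
theorem moufang (x y z : K) :
    (x * y) * (z * x) = (2 * ip (star x) (y * z)) • x - ip x x • star (y * z) :=
  ext_ip fun t => by
    -- The fourth entry is chosen so that `x * star (z * x)` collapses to `ip x x • star z`.
    have h := ip_exchange x y t (star (z * x))
    rw [star_mul, mul_star_cancel, ip_comm y, ip_mul_right (star x), star_star,
      LinearMap.map_smul₂, smul_eq_mul, ip_comm (star z), ip_mul_right t, ip_comm t] at h
    rw [ip_mul_right (x * y), star_mul, LinearMap.map_sub₂, LinearMap.map_smul₂,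
      LinearMap.map_smul₂, smul_eq_mul, smul_eq_mul, star_mul]
    linear_combination h

end Composition

/-! ## Coordinates on vectors and spinors -/

section Coordinates

variable {K : Type} [NormedDivisionAlgebra K]

theorem mem_herm_of (p s : ℝ) (y : K) : !![p • 1, y; star y, s • 1] ∈ herm K := by
  change (_ : Matrix (Fin 2) (Fin 2) K)ᴴ = _
  ext i j
  fin_cases i <;> fin_cases j <;> simp [star_smul']

/-- The vector with blocks `a, Ã; A, -a`, where `A` has the rows `p, y` and `y*, s`. -/
noncomputable def vec (a p s : ℝ) (y : K) : Vec K :=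
  .mk (vecMatrix a !![p • 1, y; star y, s • 1]) ⟨a, _, mem_herm_of p s y, rfl⟩

theorem vec_mat (a p s : ℝ) (y : K) :
    (vec a p s y).mat = vecMatrix a !![p • 1, y; star y, s • 1] := rfl

theorem exists_vec (M : Vec K) : ∃ a p s y, M = vec a p s y := by
  obtain ⟨a, A, hA, h⟩ := M.mat_mem
  refine ⟨a, NormedDivisionAlgebra.re (A 0 0), NormedDivisionAlgebra.re (A 1 1), A 0 1, Vec.ext ?_⟩
  rw [h, vec_mat]
  congr 1
  ext i j
  fin_cases i <;> fin_cases j <;> simp [← herm_diag hA, herm_off hA]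

theorem vec_add (a p s a' p' s' : ℝ) (y y' : K) :
    vec a p s y + vec a' p' s' y' = vec (a + a') (p + p') (s + s') (y + y') := by
  refine Vec.ext ?_
  rw [Vec.mat_add, vec_mat, vec_mat, vec_mat, vecMatrix_add]
  congr 1
  ext i j
  fin_cases i <;> fin_cases j <;> simp [add_smul]

theorem vec_smul (r a p s : ℝ) (y : K) :
    r • vec a p s y = vec (r * a) (r * p) (r * s) (r • y) := by
  refine Vec.ext ?_
  rw [Vec.mat_smul, vec_mat, vec_mat, vecMatrix_smul]
  congr 1
  ext i j
  fin_cases i <;> fin_cases j <;> simp [mul_smul, star_smul']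

theorem gamma_vec (a p s : ℝ) (y : K) (Ψ : Spinor K) :
    gamma K (vec a p s y) Ψ =
      Sum.elim
        ![a • Ψ (.inl 0) - s • Ψ (.inr 0) + y * Ψ (.inr 1),
          a • Ψ (.inl 1) + star y * Ψ (.inr 0) - p • Ψ (.inr 1)]
        ![p • Ψ (.inl 0) + y * Ψ (.inl 1) - a • Ψ (.inr 0),
          star y * Ψ (.inl 0) + s • Ψ (.inl 1) - a • Ψ (.inr 1)] := by
  change (vec a p s y).mat *ᵥ Ψ = _
  ext i
  rcases i with i | i <;> fin_cases i <;>
    simp [vec_mat, vecMatrix, traceRev, Matrix.mulVec, dotProduct, Matrix.trace,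
      Fin.sum_univ_two, Matrix.one_apply] <;> abel

theorem pairing_eq (Ψ Φ : Spinor K) :
    pairing K Ψ Φ = ip (Ψ (.inr 0)) (Φ (.inl 0)) + ip (Ψ (.inr 1)) (Φ (.inl 1)) -
      ip (Ψ (.inl 0)) (Φ (.inr 0)) - ip (Ψ (.inl 1)) (Φ (.inr 1)) := by
  change NormedDivisionAlgebra.re (star Ψ ⬝ᵥ (gammaZero K *ᵥ Φ)) = _
  simp [gammaZero, Matrix.mulVec, dotProduct, Fin.sum_univ_two, Matrix.one_apply, re_mul]
  ring

theorem minkowski_comm (A B : Vec K) : minkowski K A B = minkowski K B A := by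
  simp only [minkowski_apply, Matrix.trace, Matrix.diag, Matrix.mul_apply, map_sum]
  rw [Finset.sum_comm]
  have h : ∀ a b : K,
      NormedDivisionAlgebra.re (a * b) = NormedDivisionAlgebra.re (b * a) := fun a b => by
    rw [re_mul, re_mul, ← ip_star_star, star_star, ip_comm]
  simp only [h (A.mat _ _)]

/-- Polarization of `minkowski_self`. -/
theorem minkowski_vec (a p s a' p' s' : ℝ) (y y' : K) :
    minkowski K (vec a p s y) (vec a' p' s' y') =
      a * a' - (p * s' + p' * s) / 2 + ip y y' := by
  have key : ∀ (a p s : ℝ) (y : K),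
      minkowski K (vec a p s y) (vec a p s y) = a ^ 2 - p * s + ip y y := by
    intro a p s y
    rw [vec, minkowski_self _ _ (mem_herm_of p s y)]
    simp [ip_apply, NormedDivisionAlgebra.re_one]
    ring
  have h := key (a + a') (p + p') (s + s') (y + y')
  simp only [← vec_add, map_add, LinearMap.add_apply, key] at h
  rw [minkowski_comm (vec a' p' s' y')] at h
  have := ip_comm y y'
  linear_combination (1 / 2) * h - (1 / 2) * this

/-! ## The Clifford action -/

theorem pairing_skew (Ψ Φ : Spinor K) : pairing K Ψ Φ = -pairing K Φ Ψ := by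
  simp only [pairing_eq, ip_comm (Φ _)]
  ring

/-- Multiplications by `y` and `star y` are adjoint. This symmetry is what makes the bracket of two
spinors symmetric, as it must be for odd elements. -/
theorem pairing_gamma_comm (A : Vec K) (Ψ Φ : Spinor K) :
    pairing K Ψ (gamma K A Φ) = pairing K Φ (gamma K A Ψ) := by
  obtain ⟨a, p, s, y, rfl⟩ := exists_vec A
  have h : ∀ b c : K, ip c (y * b) = ip b (star y * c) := fun b c => by
    rw [ip_comm, ip_mul_left]
  simp only [pairing_eq, gamma_vec, Sum.elim_inl, Sum.elim_inr, Matrix.cons_val_zero,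
    Matrix.cons_val_one, map_add, map_sub, map_smul, smul_eq_mul, h, ip_comm (Φ _) (Ψ _)]
  ring

theorem pairing_gamma_left (A : Vec K) (Ψ Φ : Spinor K) :
    pairing K (gamma K A Ψ) Φ = -pairing K Ψ (gamma K A Φ) := by
  rw [pairing_skew, pairing_gamma_comm]

/-- The only products of three factors from `K` that occur are `y * (star y * b)` and `star y * (y *
b)`, so the cancellation laws suffice and associativity is not needed. -/
theorem gamma_sq (A : Vec K) : gamma K A * gamma K A = minkowski K A A • 1 := by
  obtain ⟨a, p, s, y, rfl⟩ := exists_vec A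
  refine LinearMap.ext fun Ψ => funext fun i => ?_
  rw [Module.End.mul_apply, minkowski_vec, gamma_vec, gamma_vec]
  rcases i with i | i <;> fin_cases i <;>
    simp [mul_add, mul_sub, mul_smul_comm, mul_star_cancel, star_mul_cancel] <;> module

theorem gamma_mul_add (A B : Vec K) :
    gamma K A * gamma K B + gamma K B * gamma K A = (2 * minkowski K A B) • 1 := by
  have h := gamma_sq (A + B)
  simp only [map_add, LinearMap.add_apply, add_mul, mul_add, gamma_sq] at h
  rw [minkowski_comm B A] at h
  rw [← sub_eq_zero] at h ⊢
  rw [← h]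
  module

end Coordinates

/-! ## The spinor representation -/

section SpinRep

variable {K : Type} [NormedDivisionAlgebra K]

theorem commutator_mul {R : Type*} [Ring R] (a b c : R) :
    a * (b * c) - b * c * a = (a * b - b * a) * c + b * (a * c - c * a) := by
  noncomm_ring

theorem clifford_commutator {R : Type*} [Ring R] [Algebra ℝ R] (a b c : R) (r s : ℝ)
    (h₁ : b * c + c * b = r • 1) (h₂ : c * a + a * c = s • 1) :
    a * b * c - c * (a * b) = r • a - s • b := by
  have h : a * b * c - c * (a * b) = a * (b * c + c * b) - (c * a + a * c) * b := by noncomm_ring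
  rw [h, h₁, h₂, mul_smul_comm, smul_mul_assoc, mul_one, one_mul]

/-- The chosen basis of the space of vectors. -/
noncomputable abbrev bas (K : Type) [NormedDivisionAlgebra K] := Module.finBasis ℝ (Vec K)

/-- The basis dual to the chosen one for the Minkowski metric. -/
noncomputable abbrev dbas (K : Type) [NormedDivisionAlgebra K] :=
  (minkowski K).dualBasis (minkowski_nondegenerate K) (bas K)

theorem sum_dbas (A : Vec K) : ∑ i, minkowski K A (bas K i) • dbas K i = A := by
  have h := (dbas K).sum_repr A
  simpa only [LinearMap.BilinForm.dualBasis_repr_apply] using h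

theorem sum_bas (A : Vec K) : ∑ i, minkowski K (dbas K i) A • bas K i = A := by
  refine ((minkowski K).toDual (minkowski_nondegenerate K)).injective (LinearMap.ext fun B => ?_)
  rw [LinearMap.BilinForm.toDual_def, LinearMap.BilinForm.toDual_def]
  conv_rhs => rw [minkowski_comm, ← sum_dbas B]
  simp only [map_sum, map_smul, LinearMap.sum_apply, LinearMap.smul_apply, smul_eq_mul]
  refine Finset.sum_congr rfl fun i _ => ?_
  rw [minkowski_comm (bas K i) B, mul_comm]

theorem so_skew (X : so K) (A B : Vec K) :
    minkowski K (X.1 A) B = -minkowski K A (X.1 B) := by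
  have h := X.2
  rw [LinearMap.mem_skewAdjointSubmodule] at h
  have := h A B
  simpa using this

/-- Moving a skew-adjoint map between the two legs of the canonical tensor. -/
theorem sum_skew {W : Type*} [AddCommGroup W] [Module ℝ W] (F : Vec K →ₗ[ℝ] Vec K →ₗ[ℝ] W)
    (X : so K) :
    ∑ i, F (bas K i) (X.1 (dbas K i)) = -∑ i, F (X.1 (bas K i)) (dbas K i) := by
  have h1 : ∀ i, F (bas K i) (X.1 (dbas K i)) =
      ∑ j, minkowski K (X.1 (dbas K i)) (bas K j) • F (bas K i) (dbas K j) := fun i => by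
    conv_lhs => rw [← sum_dbas (X.1 (dbas K i))]
    simp only [map_sum, map_smul]
  have h2 : ∀ j, F (X.1 (bas K j)) (dbas K j) =
      ∑ i, minkowski K (dbas K i) (X.1 (bas K j)) • F (bas K i) (dbas K j) := fun j => by
    conv_lhs => rw [← sum_bas (X.1 (bas K j))]
    simp only [map_sum, map_smul, LinearMap.sum_apply, LinearMap.smul_apply]
  simp only [h1, h2, so_skew, neg_smul, Finset.sum_neg_distrib]
  rw [Finset.sum_comm]

/-- The canonical tensor is symmetric. -/
theorem sum_swap {W : Type*} [AddCommGroup W] [Module ℝ W] (F : Vec K →ₗ[ℝ] Vec K →ₗ[ℝ] W) :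
    ∑ i, F (dbas K i) (bas K i) = ∑ i, F (bas K i) (dbas K i) := by
  have h1 : ∀ i, F (dbas K i) (bas K i) =
      ∑ j, minkowski K (bas K i) (bas K j) • F (dbas K i) (dbas K j) := fun i => by
    conv_lhs => rw [← sum_dbas (bas K i)]
    simp only [map_sum, map_smul]
  have h2 : ∀ j, F (bas K j) (dbas K j) =
      ∑ i, minkowski K (bas K j) (bas K i) • F (dbas K i) (dbas K j) := fun j => by
    conv_lhs => rw [← sum_dbas (bas K j)]
    simp only [map_sum, map_smul, LinearMap.sum_apply, LinearMap.smul_apply]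
  simp only [h1, h2]
  rw [Finset.sum_comm]
  simp only [minkowski_comm (bas K _) (bas K _)]

/-- Commuting `gamma K A` past each product of two gammas leaves two contractions. Each of them sums
to twice Γ(X𝒜), and the factor 1/4 absorbs the total. -/
theorem spin_gamma (X : so K) (A : Vec K) :
    spin K X * gamma K A - gamma K A * spin K X = gamma K (X.1 A) := by
  have h : ∀ i, gamma K (X.1 (bas K i)) * gamma K (dbas K i) * gamma K A -
      gamma K A * (gamma K (X.1 (bas K i)) * gamma K (dbas K i)) =
      (2 * minkowski K (dbas K i) A) • gamma K (X.1 (bas K i)) +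
      (2 * minkowski K (X.1 A) (bas K i)) • gamma K (dbas K i) := by
    intro i
    refine (clifford_commutator _ _ _ _ _ (gamma_mul_add (dbas K i) A)
      (gamma_mul_add A (X.1 (bas K i)))).trans ?_
    rw [so_skew, mul_neg]
    exact (sub_eq_add_neg _ _).trans (congrArg _ (neg_smul _ _).symm)
  rw [spin_apply, smul_mul_assoc, mul_smul_comm]
  refine (smul_sub _ _ _).symm.trans ?_
  rw [Finset.sum_mul, Finset.mul_sum,
    ← Finset.sum_sub_distrib, Finset.sum_congr rfl fun i _ => h i, Finset.sum_add_distrib]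
  have h1 : ∑ i, (2 * minkowski K (dbas K i) A) • gamma K (X.1 (bas K i)) =
      (2 : ℝ) • gamma K (X.1 A) := by
    conv_rhs => rw [← sum_bas A]
    simp only [map_sum, map_smul, Finset.smul_sum, smul_smul]
  have h2 : ∑ i, (2 * minkowski K (X.1 A) (bas K i)) • gamma K (dbas K i) =
      (2 : ℝ) • gamma K (X.1 A) := by
    conv_rhs => rw [← sum_dbas (X.1 A)]
    simp only [map_sum, map_smul, Finset.smul_sum, smul_smul]
  rw [h1, h2]
  module

/-- By `spin_gamma`, the commutator with `spin K X` is a derivation that applies `X` to each gamma.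
Invariance of the canonical tensor moves the second `X` to the first leg with a minus sign,
producing the commutator of `X` and `Y` there. -/
theorem spin_bracket (X Y : so K) :
    spin K (soBracket K X Y) = spin K X * spin K Y - spin K Y * spin K X := by
  have h : ∀ i, spin K X * (gamma K (Y.1 (bas K i)) * gamma K (dbas K i)) -
      gamma K (Y.1 (bas K i)) * gamma K (dbas K i) * spin K X =
      gamma K (X.1 (Y.1 (bas K i))) * gamma K (dbas K i) +
        gamma K (Y.1 (bas K i)) * gamma K (X.1 (dbas K i)) := fun i => by
    rw [← spin_gamma X, ← spin_gamma X]
    exact commutator_mul _ _ _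
  have h2 := sum_skew (((LinearMap.mul ℝ (Module.End ℝ (Spinor K))).compl₁₂
    (gamma K ∘ₗ Y.1) (gamma K))) X
  simp only [LinearMap.compl₁₂_apply, LinearMap.mul_apply', LinearMap.comp_apply] at h2
  rw [spin_apply K Y, smul_mul_assoc, mul_smul_comm]
  refine Eq.trans ?_ (smul_sub _ _ _)
  rw [Finset.sum_mul, Finset.mul_sum,
    ← Finset.sum_sub_distrib, Finset.sum_congr rfl fun i _ => h i, Finset.sum_add_distrib, h2,
    spin_apply, ← sub_eq_add_neg, ← Finset.sum_sub_distrib]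
  congr 1
  refine Finset.sum_congr rfl fun i _ => ?_
  rw [← sub_mul, ← map_sub]
  rfl

/-- Each gamma is skew for the pairing, so the adjoint of a product of two gammas is the reversed
product. Restoring the order by `sum_swap` and `sum_skew` costs one minus sign. -/
theorem pairing_spin (X : so K) (Ψ Φ : Spinor K) :
    pairing K (spin K X Ψ) Φ = -pairing K Ψ (spin K X Φ) := by
  have h := (sum_swap ((LinearMap.mul ℝ (Module.End ℝ (Spinor K))).compl₁₂
    (gamma K) (gamma K ∘ₗ X.1))).trans
    (sum_skew ((LinearMap.mul ℝ (Module.End ℝ (Spinor K))).compl₁₂ (gamma K) (gamma K)) X)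
  simp only [LinearMap.compl₁₂_apply, LinearMap.mul_apply', LinearMap.comp_apply] at h
  have h' := congrArg (fun f => pairing K Ψ (f Φ)) h
  simp only [LinearMap.neg_apply, LinearMap.sum_apply, Module.End.mul_apply, map_sum, map_neg] at h'
  rw [spin_apply]
  simp only [LinearMap.smul_apply, LinearMap.sum_apply, Module.End.mul_apply, map_smul, map_sum,
    pairing_gamma_left, neg_neg, h', smul_neg]

end SpinRep

/-! ## The bracket of spinors -/

section Dot

variable {K : Type} [NormedDivisionAlgebra K]

theorem ext_minkowski {A B : Vec K} (h : ∀ C, minkowski K A C = minkowski K B C) : A = B :=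
  ((minkowski K).toDual (minkowski_nondegenerate K)).injective (LinearMap.ext h)

theorem dot_comm (Ψ Φ : Spinor K) : dot K Ψ Φ = dot K Φ Ψ :=
  ext_minkowski fun A => by rw [minkowski_dot, minkowski_dot, pairing_gamma_comm]

/-- Tested against a vector, this is the invariance of the metric, of the pairing and of the
Clifford action. It is the Jacobi identity for one Lorentz generator and two spinors. -/
theorem so_dot (X : so K) (Ψ Φ : Spinor K) :
    X.1 (dot K Ψ Φ) = dot K (spin K X Ψ) Φ + dot K Ψ (spin K X Φ) :=
  ext_minkowski fun A => by
    rw [so_skew, minkowski_dot, ← spin_gamma, map_add, LinearMap.add_apply, minkowski_dot,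
      minkowski_dot, pairing_spin, LinearMap.sub_apply, map_sub, Module.End.mul_apply,
      Module.End.mul_apply]
    ring

/-- The entries are the coefficients of `a`, `p`, `s`, `z` in ⟨Ψ, Γ(𝒜)Ψ⟩. The metric pairs `p` with
`s` with weight -1/2, so the coefficient of `s` determines the entry `p` and conversely. -/
theorem dot_self (Ψ : Spinor K) : dot K Ψ Ψ =
    vec (2 * (ip (Ψ (.inl 0)) (Ψ (.inr 0)) + ip (Ψ (.inl 1)) (Ψ (.inr 1))))
      (2 * (ip (Ψ (.inl 1)) (Ψ (.inl 1)) + ip (Ψ (.inr 0)) (Ψ (.inr 0))))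
      (2 * (ip (Ψ (.inl 0)) (Ψ (.inl 0)) + ip (Ψ (.inr 1)) (Ψ (.inr 1))))
      ((2 : ℝ) • (Ψ (.inr 0) * star (Ψ (.inr 1)) - Ψ (.inl 0) * star (Ψ (.inl 1)))) :=
  ext_minkowski fun A => by
    obtain ⟨a, p, s, z, rfl⟩ := exists_vec A
    rw [minkowski_dot, minkowski_vec, pairing_eq, gamma_vec]
    generalize Ψ (.inl 0) = x
    generalize Ψ (.inl 1) = y
    generalize Ψ (.inr 0) = u
    generalize Ψ (.inr 1) = w
    have h : ∀ b c : K, ip c (star z * b) = ip b (z * c) := fun b c => by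
      rw [ip_comm b, ip_mul_left]
    have h2 : ∀ b c : K, ip (b * star c) z = ip b (z * c) := fun b c => by
      rw [ip_mul_right, star_star]
    simp only [Sum.elim_inl, Sum.elim_inr, Matrix.cons_val_zero, Matrix.cons_val_one, map_add,
      map_sub, map_smul, smul_eq_mul, h, h2, ip_comm u x, ip_comm w y, LinearMap.sub_apply,
      LinearMap.smul_apply]
    ring

/-- The spinor identity behind the cocycle condition, in quadratic form. -/
theorem pairing_gamma_dot_self (Ψ : Spinor K) (A : Vec K) :
    pairing K (gamma K (dot K Ψ Ψ) Ψ) (gamma K A Ψ) = 0 := by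
  obtain ⟨a, p, s, z, rfl⟩ := exists_vec A
  rw [dot_self, pairing_eq, gamma_vec, gamma_vec]
  generalize Ψ (.inl 0) = x
  generalize Ψ (.inl 1) = y
  generalize Ψ (.inr 0) = u
  generalize Ψ (.inr 1) = w
  -- The quartic terms involving all four components reduce to the single number `ip (x * star y *
  -- w) u`, so they can cancel.
  have e1 : ip (u * star w * y) x = ip (x * star y * w) u := by
    rw [ip_mul_right, ip_comm, ip_mul_right (x * star y)]
  have e2 : ip (w * star u * x) y = ip (x * star y * w) u := by
    rw [← e1, ip_mul_left, star_mul, star_star, ip_comm]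
  have e3 : ip (y * star x * u) w = ip (x * star y * w) u := by
    rw [ip_mul_left, star_mul, star_star, ip_comm]
  have n1 : ∀ b c d : K, ip (b * star c * d) b = ip b b * ip d c := fun b c d => by
    rw [ip_mul_left, star_mul, star_star, mul_star_mul, map_smul, smul_eq_mul]
  -- Moving `b * star c` to the other side gives `(c * star b) * (z * c)`, a Moufang product.
  have m1 : ∀ b c d : K, ip (b * star c * d) (z * c) =
      2 * ip c (star z * b) * ip d c - ip c c * ip d (star z * b) := fun b c d => by
    rw [ip_mul_left, star_mul, star_star, moufang, map_sub, map_smul, map_smul, smul_eq_mul,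
      smul_eq_mul, ← ip_star_star (star c), star_star, star_mul, star_star]
  have m2 : ∀ b c d : K, ip (b * star c * d) (star z * c) =
      2 * ip c (z * b) * ip d c - ip c c * ip d (z * b) := fun b c d => by
    rw [ip_mul_left, star_mul, star_star, moufang, map_sub, map_smul, map_smul, smul_eq_mul,
      smul_eq_mul, ← ip_star_star (star c), star_star, star_mul, star_star, star_star]
  have z1 : ∀ b c : K, ip b (star z * c) = ip c (z * b) := fun b c => by
    rw [ip_comm c, ip_mul_left]
  simp only [Sum.elim_inl, Sum.elim_inr, Matrix.cons_val_zero, Matrix.cons_val_one, star_sub,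
    star_smul', star_mul, star_star, sub_mul, smul_mul_assoc, mul_star_mul, map_add, map_sub,
    map_smul, smul_eq_mul, LinearMap.add_apply, LinearMap.sub_apply, LinearMap.smul_apply, smul_sub,
    m1, m2, z1, e1, e2, e3, n1, ip_comm u x, ip_comm w y]
  ring

end Dot

/-! ## The quadrilinear form `⟨Ψ, [𝒜, 𝒞] Φ⟩` -/

section Bi

variable {K : Type} [NormedDivisionAlgebra K]

/-- The form `⟨Ψ, (Γ(𝒜) Γ(𝒞) - Γ(𝒞) Γ(𝒜)) Φ⟩`. -/
noncomputable def bi (Ψ Φ : Spinor K) (A C : Vec K) : ℝ :=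
  pairing K Ψ ((gamma K A * gamma K C - gamma K C * gamma K A) Φ)

theorem bi_eq (Ψ Φ : Spinor K) (A C : Vec K) :
    bi Ψ Φ A C = pairing K Ψ (gamma K A (gamma K C Φ)) - pairing K Ψ (gamma K C (gamma K A Φ)) := by
  rw [bi, LinearMap.sub_apply, map_sub]
  rfl

theorem bi_comm (Ψ Φ : Spinor K) (A C : Vec K) : bi Ψ Φ A C = bi Φ Ψ A C := by
  have h : ∀ A C : Vec K, pairing K Ψ (gamma K A (gamma K C Φ)) =
      -pairing K Φ (gamma K C (gamma K A Ψ)) := fun A C => by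
    rw [← neg_neg (pairing K Ψ _), ← pairing_gamma_left, pairing_gamma_comm]
  rw [bi_eq, bi_eq, h, h]
  ring

theorem bi_skew (Ψ Φ : Spinor K) (A C : Vec K) : bi Ψ Φ A C = -bi Ψ Φ C A := by
  rw [bi_eq, bi_eq]
  ring

theorem bi_zero₁ (Φ : Spinor K) (A C : Vec K) : bi 0 Φ A C = 0 := by simp [bi]

theorem bi_zero₂ (Ψ : Spinor K) (A C : Vec K) : bi Ψ 0 A C = 0 := by simp [bi]

theorem bi_zero₃ (Ψ Φ : Spinor K) (C : Vec K) : bi Ψ Φ 0 C = 0 := by simp [bi]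

theorem bi_zero₄ (Ψ Φ : Spinor K) (A : Vec K) : bi Ψ Φ A 0 = 0 := by simp [bi]

theorem bi_add₁ (Ψ Ψ' Φ : Spinor K) (A C : Vec K) :
    bi (Ψ + Ψ') Φ A C = bi Ψ Φ A C + bi Ψ' Φ A C := by
  rw [bi, map_add, LinearMap.add_apply, bi, bi]

theorem bi_neg₁ (Ψ Φ : Spinor K) (A C : Vec K) : bi (-Ψ) Φ A C = -bi Ψ Φ A C := by
  rw [bi, map_neg, LinearMap.neg_apply, bi]

theorem bi_add₂ (Ψ Φ Φ' : Spinor K) (A C : Vec K) :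
    bi Ψ (Φ + Φ') A C = bi Ψ Φ A C + bi Ψ Φ' A C := by
  rw [bi_comm, bi_add₁, bi_comm Φ, bi_comm Φ']

theorem bi_neg₂ (Ψ Φ : Spinor K) (A C : Vec K) : bi Ψ (-Φ) A C = -bi Ψ Φ A C := by
  rw [bi_comm, bi_neg₁, bi_comm]

theorem bi_add₃ (Ψ Φ : Spinor K) (A A' C : Vec K) :
    bi Ψ Φ (A + A') C = bi Ψ Φ A C + bi Ψ Φ A' C := by
  simp only [bi_eq, map_add, LinearMap.add_apply]
  ring

theorem bi_neg₃ (Ψ Φ : Spinor K) (A C : Vec K) : bi Ψ Φ (-A) C = -bi Ψ Φ A C := by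
  simp only [bi_eq, map_neg, LinearMap.neg_apply]
  ring

theorem bi_sub₃ (Ψ Φ : Spinor K) (A A' C : Vec K) :
    bi Ψ Φ (A - A') C = bi Ψ Φ A C - bi Ψ Φ A' C := by
  rw [sub_eq_add_neg, bi_add₃, bi_neg₃, sub_eq_add_neg]

/-- Lorentz invariance. -/
theorem bi_invariant (X : so K) (Ψ Φ : Spinor K) (A C : Vec K) :
    bi (spin K X Ψ) Φ A C + bi (spin K X Φ) Ψ A C + bi Ψ Φ (X.1 A) C - bi Ψ Φ (X.1 C) A = 0 := by
  rw [bi_comm (spin K X Φ), bi_skew Ψ Φ (X.1 C)]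
  simp only [bi_eq, ← spin_gamma, pairing_spin, LinearMap.sub_apply, Module.End.mul_apply, map_sub]
  ring

/-- Moving one gamma across the pairing shows that each of the two orders in the commutator vanishes
separately. -/
theorem bi_dot_self (Ψ : Spinor K) (A : Vec K) : bi Ψ Ψ (dot K Ψ Ψ) A = 0 := by
  have h := pairing_gamma_dot_self Ψ A
  have h' := pairing_skew (gamma K A Ψ) (gamma K (dot K Ψ Ψ) Ψ)
  rw [pairing_gamma_left] at h h'
  rw [pairing_gamma_left] at h'
  rw [bi_eq]
  linarith

/-- Adding the quartic identity at Ψ + Φ and at Ψ - Φ isolates the part of degree two in each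
spinor. -/
theorem bi_dot_biquadratic (Ψ Φ : Spinor K) (A : Vec K) :
    bi Ψ Ψ (dot K Φ Φ) A + bi Φ Φ (dot K Ψ Ψ) A + 4 * bi Ψ Φ (dot K Ψ Φ) A = 0 := by
  have h₁ := bi_dot_self (Ψ + Φ) A
  have h₂ := bi_dot_self (Ψ + -Φ) A
  simp only [map_add, map_neg, LinearMap.add_apply, LinearMap.neg_apply, bi_add₁, bi_add₂, bi_add₃,
    bi_neg₁, bi_neg₂, bi_neg₃, bi_dot_self, dot_comm Φ Ψ, bi_comm Φ Ψ] at h₁ h₂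
  linarith

/-- The spinor identity behind the cocycle condition, in quadrilinear form. -/
theorem bi_dot_sum (Ψ₁ Ψ₂ Ψ₃ Ψ₄ : Spinor K) (A : Vec K) :
    bi Ψ₃ Ψ₄ (dot K Ψ₁ Ψ₂) A + bi Ψ₂ Ψ₄ (dot K Ψ₁ Ψ₃) A + bi Ψ₂ Ψ₃ (dot K Ψ₁ Ψ₄) A +
      bi Ψ₁ Ψ₄ (dot K Ψ₂ Ψ₃) A + bi Ψ₁ Ψ₃ (dot K Ψ₂ Ψ₄) A + bi Ψ₁ Ψ₂ (dot K Ψ₃ Ψ₄) A = 0 := by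
  -- Inclusion–exclusion over both sums leaves the part linear in each of the four spinors.
  have h := bi_dot_biquadratic (Ψ₁ + Ψ₂) (Ψ₃ + Ψ₄) A
  have h₁ := bi_dot_biquadratic Ψ₁ (Ψ₃ + Ψ₄) A
  have h₂ := bi_dot_biquadratic Ψ₂ (Ψ₃ + Ψ₄) A
  have h₃ := bi_dot_biquadratic (Ψ₁ + Ψ₂) Ψ₃ A
  have h₄ := bi_dot_biquadratic (Ψ₁ + Ψ₂) Ψ₄ A
  have h₁₃ := bi_dot_biquadratic Ψ₁ Ψ₃ A
  have h₁₄ := bi_dot_biquadratic Ψ₁ Ψ₄ A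
  have h₂₃ := bi_dot_biquadratic Ψ₂ Ψ₃ A
  have h₂₄ := bi_dot_biquadratic Ψ₂ Ψ₄ A
  simp only [map_add, LinearMap.add_apply, bi_add₁, bi_add₂, bi_add₃, dot_comm Ψ₂ Ψ₁,
    bi_comm Ψ₂ Ψ₁, dot_comm Ψ₄ Ψ₃, bi_comm Ψ₄ Ψ₃] at h h₁ h₂ h₃ h₄
  linarith

/-! ## The form `β` on arbitrary arguments -/

/-- A permutation from two mutually inverse functions on `Fin n`. -/
abbrev permOf {n : ℕ} (f g : Fin n → Fin n) (h₁ : ∀ i, g (f i) = i := by decide)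
    (h₂ : ∀ i, f (g i) = i := by decide) : Equiv.Perm (Fin n) := ⟨f, g, h₁, h₂⟩

theorem isUnshuffle_two_two : ∀ σ : Equiv.Perm (Fin 4), (σ 0 < σ 1 ∧ σ 2 < σ 3) ↔
    σ ∈ ({permOf ![0, 1, 2, 3] ![0, 1, 2, 3], permOf ![0, 2, 1, 3] ![0, 2, 1, 3],
      permOf ![0, 3, 1, 2] ![0, 2, 3, 1], permOf ![1, 2, 0, 3] ![2, 0, 1, 3],
      permOf ![1, 3, 0, 2] ![2, 0, 3, 1],
      permOf ![2, 3, 0, 1] ![2, 3, 0, 1]} : Finset (Equiv.Perm (Fin 4))) := by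
  decide

theorem beta_eq (t : Fin 4 → T K) :
    beta K t = bi (t 0).2 (t 1).2 (t 2).1 (t 3).1 - bi (t 0).2 (t 2).2 (t 1).1 (t 3).1 +
      bi (t 0).2 (t 3).2 (t 1).1 (t 2).1 + bi (t 1).2 (t 2).2 (t 0).1 (t 3).1 -
      bi (t 1).2 (t 3).2 (t 0).1 (t 2).1 + bi (t 2).2 (t 3).2 (t 0).1 (t 1).1 := by
  classical
  have hiff : ∀ σ : Equiv.Perm (Fin 4),
      LInftyData.IsUnshuffle (i := 2) (m := 2) σ ↔ (σ 0 < σ 1 ∧ σ 2 < σ 3) := fun σ => by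
    simp only [LInftyData.IsUnshuffle, Fin.strictMono_iff_lt_succ, Fin.forall_fin_one]
    rfl
  simp only [beta, hiff, isUnshuffle_two_two]
  rw [← Finset.sum_filter, Finset.filter_mem_eq_inter, Finset.univ_inter]
  have hs : ∀ t : Fin 4 → T K, betaAux K t = bi (t 0).2 (t 1).2 (t 2).1 (t 3).1 := fun t => rfl
  rw [Finset.sum_insert (by decide), Finset.sum_insert (by decide), Finset.sum_insert (by decide),
    Finset.sum_insert (by decide), Finset.sum_insert (by decide), Finset.sum_singleton]
  rw [show Equiv.Perm.sign (permOf ![0, 1, 2, 3] ![0, 1, 2, 3] : Equiv.Perm (Fin 4)) = 1 by decide,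
    show Equiv.Perm.sign (permOf ![0, 2, 1, 3] ![0, 2, 1, 3] : Equiv.Perm (Fin 4)) = -1 by decide,
    show Equiv.Perm.sign (permOf ![0, 3, 1, 2] ![0, 2, 3, 1] : Equiv.Perm (Fin 4)) = 1 by decide,
    show Equiv.Perm.sign (permOf ![1, 2, 0, 3] ![2, 0, 1, 3] : Equiv.Perm (Fin 4)) = 1 by decide,
    show Equiv.Perm.sign (permOf ![1, 3, 0, 2] ![2, 0, 3, 1] : Equiv.Perm (Fin 4)) = -1 by decide,
    show Equiv.Perm.sign (permOf ![2, 3, 0, 1] ![2, 3, 0, 1] : Equiv.Perm (Fin 4)) = 1 by decide]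
  simp [hs]
  ring

end Bi

/-! ## Koszul signs -/

section Koszul

theorem sgn_zero : sgn 0 = 1 := if_pos rfl

theorem sgn_one : sgn 1 = -1 := if_neg (by decide)

theorem sgn_mul_self (a : ZMod 2) : sgn a * sgn a = 1 := by
  unfold sgn
  split_ifs <;> norm_num

/-- The sign picked up by exchanging elements of grades `q i` and `q j` if `j < i`. -/
noncomputable def exchangeSign {n : ℕ} (q : Fin n → ZMod 2) (i j : Fin n) : ℝ :=
  -- The value 0 on the diagonal keeps `exchangeSign_swap` valid for `i = j`; it never enters `chi`,
  -- as permutations are injective.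
  if i < j then 1 else if j < i then -sgn (q i * q j) else 0

theorem exchangeSign_swap {n : ℕ} (q : Fin n → ZMod 2) (i j : Fin n) :
    exchangeSign q i j = -sgn (q i * q j) * exchangeSign q j i := by
  unfold exchangeSign
  have h := sgn_mul_self (q i * q j)
  rcases lt_trichotomy i j with hij | rfl | hij
  · rw [if_pos hij, if_neg hij.not_gt, if_pos hij, mul_comm (q j)]
    linarith
  · simp
  · rw [if_neg hij.not_gt, if_pos hij, if_pos hij, mul_one]

/-- The sign of a permutation is itself a product over pairs, so it merges with the Koszul sign into
one product. -/
theorem chi_eq_prod {n : ℕ} (σ : Equiv.Perm (Fin n)) (q : Fin n → ZMod 2) :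
    chi σ q = ∏ j, ∏ i ∈ Finset.Iio j, exchangeSign q (σ i) (σ j) := by
  rw [chi, σ.sign_eq_prod_prod_Iio, Finset.prod_comm]
  push_cast
  rw [← Finset.prod_mul_distrib]
  refine Finset.prod_congr rfl fun j _ => ?_
  have h : (Finset.Iio j) = Finset.univ.filter (· < j) := by ext; simp
  rw [h, Finset.prod_filter, Finset.prod_filter, ← Finset.prod_mul_distrib]
  refine Finset.prod_congr rfl fun i _ => ?_
  by_cases hij : i < j
  · have hne : σ i ≠ σ j := fun h => hij.ne (σ.injective h)
    rcases lt_or_gt_of_ne hne with hlt | hlt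
    · simp [hij, hlt, hlt.not_gt, exchangeSign]
    · simp [hij, hlt, hlt.not_gt, exchangeSign]
  · simp [hij]

/-- Products of symmetric functions over unordered pairs can be reindexed. -/
theorem prod_Iio_comp_of_symm {n : ℕ} (τ : Equiv.Perm (Fin n)) {f : Fin n → Fin n → ℝ}
    (hf : ∀ i j, f i j = f j i) :
    ∏ j, ∏ i ∈ Finset.Iio j, f (τ i) (τ j) = ∏ j, ∏ i ∈ Finset.Iio j, f i j := by
  have hswap : ∀ i j : Fin n, exchangeSign (fun _ => 0) i j = -exchangeSign (fun _ => 0) j i := by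
    intro i j
    rw [exchangeSign_swap, mul_zero, sgn_zero, neg_one_mul]
  have hone : ∏ j : Fin n, ∏ i ∈ Finset.Iio j, exchangeSign (fun _ => 0) i j = 1 :=
    Finset.prod_eq_one fun j _ => Finset.prod_eq_one fun i hi => if_pos (Finset.mem_Iio.mp hi)
  have h₁ := τ.prod_Iio_comp_eq_sign_mul_prod (f := exchangeSign fun _ => 0) hswap
  -- Multiplying `f` by an antisymmetric function makes the rule for antisymmetric products
  -- applicable; the sign of `τ` then cancels against `h₁`.
  have h₂ := τ.prod_Iio_comp_eq_sign_mul_prod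
    (f := fun i j => exchangeSign (fun _ => 0) i j * f i j)
    fun i j => by rw [hswap, hf i j, neg_mul]
  simp only [Finset.prod_mul_distrib] at h₂
  rw [h₁, hone, mul_one, one_mul] at h₂
  refine mul_left_cancel₀ ?_ h₂
  exact_mod_cast (Equiv.Perm.sign τ).ne_zero

/-- The exchange signs before and after relabelling by `σ` acquire the same factor when a pair is
reversed, so their product is symmetric and may be reindexed by `τ`. The second permutation sees the
grades already moved by `σ`. -/
theorem chi_mul {n : ℕ} (σ τ : Equiv.Perm (Fin n)) (q : Fin n → ZMod 2) :
    chi (σ * τ) q = chi σ q * chi τ (fun i => q (σ i)) := by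
  have h := prod_Iio_comp_of_symm τ
    (f := fun i j => exchangeSign q (σ i) (σ j) * exchangeSign (fun i => q (σ i)) i j) fun i j => by
      rw [exchangeSign_swap q, exchangeSign_swap _ i j]
      linear_combination (exchangeSign q (σ j) (σ i) * exchangeSign (fun i => q (σ i)) j i) *
        sgn_mul_self (q (σ i) * q (σ j))
  simp only [Finset.prod_mul_distrib] at h
  rw [← chi_eq_prod τ, ← chi_eq_prod σ] at h
  have hone : ∏ j : Fin n, ∏ i ∈ Finset.Iio j, exchangeSign (fun i => q (σ i)) i j = 1 :=
    Finset.prod_eq_one fun j _ => Finset.prod_eq_one fun i hi => if_pos (Finset.mem_Iio.mp hi)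
  have hsq : chi τ (fun i => q (σ i)) * chi τ (fun i => q (σ i)) = 1 := by
    rw [chi_eq_prod, ← Finset.prod_mul_distrib]
    refine Finset.prod_eq_one fun j _ => ?_
    rw [← Finset.prod_mul_distrib]
    refine Finset.prod_eq_one fun i hi => ?_
    have hne : τ i ≠ τ j := fun h => (Finset.mem_Iio.mp hi).ne (τ.injective h)
    rcases lt_or_gt_of_ne hne with hlt | hlt
    · simp [exchangeSign, hlt]
    · simp [exchangeSign, hlt, hlt.not_gt, sgn_mul_self]
  have hστ : chi (σ * τ) q = ∏ j, ∏ i ∈ Finset.Iio j, exchangeSign q (σ (τ i)) (σ (τ j)) :=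
    chi_eq_prod _ _
  rw [hone, mul_one, ← hστ] at h
  rw [← h, mul_assoc, hsq, mul_one]

theorem chi_one {n : ℕ} (q : Fin n → ZMod 2) : chi 1 q = 1 := by
  rw [chi_eq_prod]
  exact Finset.prod_eq_one fun j _ => Finset.prod_eq_one fun i hi =>
    if_pos (Finset.mem_Iio.mp hi)

/-- A transposition of neighbours has exactly one inversion. -/
theorem chi_swap_adjacent {n : ℕ} (i : Fin n) (q : Fin (n + 1) → ZMod 2) :
    chi (Equiv.swap i.castSucc i.succ) q = -sgn (q i.castSucc * q i.succ) := by
  have hlt : i.castSucc < i.succ := Fin.castSucc_lt_succ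
  have key : ∀ a b : Fin (n + 1), a < b →
      Equiv.swap i.castSucc i.succ b < Equiv.swap i.castSucc i.succ a →
      a = i.castSucc ∧ b = i.succ := by
    intro a b h₁ h₂
    simp only [Equiv.swap_apply_def] at h₂
    split_ifs at h₂ <;> simp only [Fin.ext_iff, Fin.lt_def, Fin.val_castSucc, Fin.val_succ] at * <;>
      omega
  rw [chi, Equiv.Perm.sign_swap hlt.ne, Finset.prod_eq_single i.castSucc,
    Finset.prod_eq_single i.succ]
  · simp [hlt, mul_comm]
  · exact fun b _ hb => if_neg fun h => hb (key _ _ h.1 h.2).2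
  · simp
  · exact fun a _ ha => Finset.prod_eq_one fun b _ => if_neg fun h => ha (key _ _ h.1 h.2).1
  · simp

variable {g R : Type} [AddCommGroup g] [Module ℝ g] [AddCommGroup R] [Module ℝ R]

/-- Super-skew-symmetry only has to be checked on transpositions of neighbours. -/
theorem skew_of_adjacent (G : ZMod 2 → Submodule ℝ g) {n : ℕ}
    (ω : (Fin (n + 1) → g) → R)
    (h : ∀ (i : Fin n) (q : Fin (n + 1) → ZMod 2) (x : Fin (n + 1) → g), (∀ a, x a ∈ G (q a)) →
      ω (fun a => x (Equiv.swap i.castSucc i.succ a)) =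
        -(sgn (q i.castSucc * q i.succ) • ω x))
    (q : Fin (n + 1) → ZMod 2) (x : Fin (n + 1) → g) (hx : ∀ a, x a ∈ G (q a))
    (σ : Equiv.Perm (Fin (n + 1))) : ω (fun a => x (σ a)) = chi σ q • ω x := by
  have hσ : σ ∈ Submonoid.closure
      (Set.range fun i : Fin n => Equiv.swap i.castSucc i.succ) := by
    rw [Equiv.Perm.mclosure_swap_castSucc_succ]
    trivial
  induction hσ using Submonoid.closure_induction generalizing q x with
  | mem σ hσ =>
    obtain ⟨i, rfl⟩ := hσ
    rw [h i q x hx, chi_swap_adjacent, neg_smul]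
  | one => simp [chi_one]
  | mul σ τ _ _ ihσ ihτ =>
    have h₁ := ihτ (fun a => q (σ a)) (fun a => x (σ a)) fun a => hx (σ a)
    rw [ihσ q x hx, smul_smul, mul_comm, ← chi_mul] at h₁
    exact h₁

end Koszul

/-! ## The cocycle condition in low degree -/

section LowDegree

variable {g R : Type} [AddCommGroup g] [Module ℝ g] [AddCommGroup R] [Module ℝ R]

/-- The signed sum over the pairs among five elements of grades `q`, the chosen pair being moved to
the front. -/
noncomputable def pairSum (q : Fin 5 → ZMod 2)
    (F : Fin 5 → Fin 5 → Fin 5 → Fin 5 → Fin 5 → ℝ) : ℝ :=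
  F 0 1 2 3 4 - sgn (q 2 * q 1) * F 0 2 1 3 4 + sgn (q 3 * q 1) * sgn (q 3 * q 2) * F 0 3 1 2 4 -
    sgn (q 4 * q 1) * sgn (q 4 * q 2) * sgn (q 4 * q 3) * F 0 4 1 2 3 +
    sgn (q 1 * q 0) * sgn (q 2 * q 0) * F 1 2 0 3 4 -
    sgn (q 1 * q 0) * sgn (q 3 * q 0) * sgn (q 3 * q 2) * F 1 3 0 2 4 +
    sgn (q 1 * q 0) * sgn (q 4 * q 0) * sgn (q 4 * q 2) * sgn (q 4 * q 3) * F 1 4 0 2 3 +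
    sgn (q 2 * q 0) * sgn (q 2 * q 1) * sgn (q 3 * q 0) * sgn (q 3 * q 1) * F 2 3 0 1 4 -
    sgn (q 2 * q 0) * sgn (q 2 * q 1) * sgn (q 4 * q 0) * sgn (q 4 * q 1) * sgn (q 4 * q 3) *
      F 2 4 0 1 3 +
    sgn (q 3 * q 0) * sgn (q 3 * q 1) * sgn (q 3 * q 2) * sgn (q 4 * q 0) * sgn (q 4 * q 1) *
      sgn (q 4 * q 2) * F 3 4 0 1 2

theorem cons_eq_vec {α : Type*} (b : α) (f : Fin 3 → α) :
    (Fin.cons b f : Fin 4 → α) = ![b, f 0, f 1, f 2] := by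
  funext i
  fin_cases i <;> rfl

/-- Together with `sum_unshuffle_two_three`, this matches the Chevalley–Eilenberg signs with those
of the generalized Jacobi identity in five arguments. -/
theorem coboundary_four (br : g → g → g) (p : ZMod 2) (ω : MultilinearMap ℝ (fun _ : Fin 4 => g) ℝ)
    (q : Fin 5 → ZMod 2) (X : Fin 5 → g) :
    coboundary br (fun _ _ => 0) p ω q X =
      -pairSum q fun i j k l m => ω ![br (X i) (X j), X k, X l, X m] := by
  -- The factor `sgn (q i * q j)` cancels the factor `a = i` of the product over `a < j`; the
  -- remaining products range over all of `Fin 5`, ready for expansion.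
  have hs : ∀ (j : Fin 5) (i : Fin 4), (if i.castSucc < j then
      ((-1 : ℝ) ^ ((i : ℕ) + (j : ℕ)) * sgn (q i.castSucc * q j) *
          (∏ a ∈ Finset.Iio i.castSucc, sgn (q i.castSucc * q a)) *
          ∏ a ∈ Finset.Iio j, sgn (q j * q a)) •
        ω (Fin.cons (br (X i.castSucc) (X j)) fun k => X (j.succAbove (i.succAbove k))) else 0) =
      if i.castSucc < j then (-1 : ℝ) ^ ((i : ℕ) + (j : ℕ)) *
          (∏ a, if a < i.castSucc then sgn (q i.castSucc * q a) else 1) *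
          (∏ a, if a < j ∧ a ≠ i.castSucc then sgn (q j * q a) else 1) *
        ω (Fin.cons (br (X i.castSucc) (X j)) fun k => X (j.succAbove (i.succAbove k))) else 0 := by
    intro j i
    split_ifs with h
    · rw [← Finset.prod_filter, ← Finset.prod_filter, smul_eq_mul]
      have e₁ : Finset.univ.filter (· < i.castSucc) = Finset.Iio i.castSucc := by ext; simp
      have e₂ : Finset.univ.filter (fun a => a < j ∧ a ≠ i.castSucc) =
          (Finset.Iio j).erase i.castSucc := by ext; simp [and_comm]
      rw [e₁, e₂, ← Finset.mul_prod_erase (Finset.Iio j) _ (Finset.mem_Iio.mpr h)]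
      have hsq := sgn_mul_self (q j * q i.castSucc)
      rw [mul_comm (q i.castSucc) (q j)]
      linear_combination ((-1 : ℝ) ^ ((i : ℕ) + (j : ℕ)) *
        (∏ a ∈ Finset.Iio i.castSucc, sgn (q i.castSucc * q a)) *
        (∏ a ∈ (Finset.Iio j).erase i.castSucc, sgn (q j * q a)) *
        ω (Fin.cons (br (X i.castSucc) (X j)) fun k => X (j.succAbove (i.succAbove k)))) * hsq
    · rfl
  simp only [coboundary, smul_zero, Finset.sum_const_zero, zero_add]
  rw [Finset.sum_congr rfl fun j _ => Finset.sum_congr rfl fun i _ => hs j i]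
  simp [cons_eq_vec, Fin.sum_univ_succ, Fin.prod_univ_succ, Fin.succAbove, pairSum]
  ring

theorem isUnshuffle_two_three : ∀ σ : Equiv.Perm (Fin 5), (σ 0 < σ 1 ∧ σ 2 < σ 3 ∧ σ 3 < σ 4) ↔
    σ ∈ ({permOf ![0, 1, 2, 3, 4] ![0, 1, 2, 3, 4], permOf ![0, 2, 1, 3, 4] ![0, 2, 1, 3, 4],
      permOf ![0, 3, 1, 2, 4] ![0, 2, 3, 1, 4], permOf ![0, 4, 1, 2, 3] ![0, 2, 3, 4, 1],
      permOf ![1, 2, 0, 3, 4] ![2, 0, 1, 3, 4], permOf ![1, 3, 0, 2, 4] ![2, 0, 3, 1, 4],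
      permOf ![1, 4, 0, 2, 3] ![2, 0, 3, 4, 1], permOf ![2, 3, 0, 1, 4] ![2, 3, 0, 1, 4],
      permOf ![2, 4, 0, 1, 3] ![2, 3, 0, 4, 1],
      permOf ![3, 4, 0, 1, 2] ![2, 3, 4, 0, 1]} : Finset (Equiv.Perm (Fin 5))) := by
  set_option maxRecDepth 100000 in decide

open Classical in
-- A (2,3)-unshuffle is determined by its first two values, so there is one term for each of the ten
-- pairs.
theorem sum_unshuffle_two_three (q : Fin 5 → ZMod 2)
    (F : Fin 5 → Fin 5 → Fin 5 → Fin 5 → Fin 5 → ℝ) :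
    (∑ σ : Equiv.Perm (Fin 5), if LInftyData.IsUnshuffle (i := 2) (m := 3) σ then
      chi σ q * F (σ 0) (σ 1) (σ 2) (σ 3) (σ 4) else 0) = pairSum q F := by
  have hiff : ∀ σ : Equiv.Perm (Fin 5),
      LInftyData.IsUnshuffle (i := 2) (m := 3) σ ↔
        (σ 0 < σ 1 ∧ σ 2 < σ 3 ∧ σ 3 < σ 4) := fun σ => by
    simp only [LInftyData.IsUnshuffle, Fin.strictMono_iff_lt_succ, Fin.forall_fin_one,
      Fin.forall_fin_two]
    rfl
  simp only [hiff, isUnshuffle_two_three]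
  rw [← Finset.sum_filter, Finset.filter_mem_eq_inter, Finset.univ_inter]
  rw [Finset.sum_insert (by decide), Finset.sum_insert (by decide), Finset.sum_insert (by decide),
    Finset.sum_insert (by decide), Finset.sum_insert (by decide), Finset.sum_insert (by decide),
    Finset.sum_insert (by decide), Finset.sum_insert (by decide), Finset.sum_insert (by decide),
    Finset.sum_singleton]
  have hp : ∀ (i : Fin 5) (f : Fin 5 → ℝ),
      ∏ a ∈ Finset.Iio i, f a = ∏ a, if a < i then f a else 1 := fun i f => by
    rw [← Finset.prod_filter]
    congr 1
    ext
    simp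
  simp [chi_eq_prod, hp, Fin.prod_univ_succ, exchangeSign]
  rw [pairSum]
  ring

end LowDegree

/-! ## Direct sum decompositions -/

section Internal

variable {ι M : Type*} [DecidableEq ι] [AddCommGroup M] [Module ℝ M]

/-- Independence holds because `π i` is the identity on `A i` and kills the span of all the other
summands. -/
theorem isInternal_of_projections {A : ι → Submodule ℝ M} (π : ι → M →ₗ[ℝ] M)
    (h₁ : ∀ i, ∀ x ∈ A i, π i x = x) (h₂ : ∀ i j, j ≠ i → ∀ x ∈ A j, π i x = 0)
    (h₃ : ∀ x, x ∈ ⨆ i, A i) : DirectSum.IsInternal A := by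
  refine DirectSum.isInternal_submodule_of_iSupIndep_of_iSup_eq_top ?_
    (eq_top_iff.mpr fun x _ => h₃ x)
  intro i
  rw [Submodule.disjoint_def]
  intro x hx hx'
  have hle : ⨆ (j) (_ : j ≠ i), A j ≤ LinearMap.ker (π i) :=
    iSup₂_le fun j hj y hy => h₂ i j hj y hy
  rw [← h₁ i x hx]
  exact hle hx'

theorem exists_projections {A : ι → Submodule ℝ M} (h : DirectSum.IsInternal A) :
    ∃ π : ι → M →ₗ[ℝ] M, (∀ i, ∀ x ∈ A i, π i x = x) ∧
      ∀ i j, j ≠ i → ∀ x ∈ A j, π i x = 0 := by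
  let _ := h.chooseDecomposition
  refine ⟨fun i => (A i).subtype ∘ₗ DirectSum.component ℝ ι (fun i => A i) i ∘ₗ
    (DirectSum.decomposeLinearEquiv A).toLinearMap, fun i x hx => ?_, fun i j hij x hx => ?_⟩
  · exact DirectSum.decompose_of_mem_same A hx
  · exact DirectSum.decompose_of_mem_ne A hx hij

end Internal

/-! ## Lie superalgebras and their extensions as `L_∞`-superalgebras -/

section Extension

variable {L : Type} [AddCommGroup L] [Module ℝ L] {G : ZMod 2 → Submodule ℝ L}
  {br : L →ₗ[ℝ] L →ₗ[ℝ] L}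

theorem sgn_add (a b : ZMod 2) : sgn (a + b) = sgn a * sgn b := by
  have h : ∀ a : ZMod 2, a = 0 ∨ a = 1 := by decide
  have h₂ : (1 + 1 : ZMod 2) = 0 := by decide
  rcases h a with rfl | rfl <;> rcases h b with rfl | rfl <;> simp [sgn_zero, sgn_one, h₂]

theorem IsLieSuperalgebra.skew_perm (hL : IsLieSuperalgebra G br) (q : Fin 2 → ZMod 2)
    (x : Fin 2 → L) (hx : ∀ a, x a ∈ G (q a)) (σ : Equiv.Perm (Fin 2)) :
    toMultilinear br (fun a => x (σ a)) = chi σ q • toMultilinear br x := by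
  refine skew_of_adjacent G (toMultilinear br) ?_ q x hx σ
  intro i q x hx
  obtain rfl : i = 0 := Subsingleton.elim _ _
  have := hL.skew (q 1) (q 0) (x 1) (hx 1) (x 0) (hx 0)
  rw [mul_comm] at this
  exact this

theorem isUnshuffle_two_one : ∀ σ : Equiv.Perm (Fin 3), σ 0 < σ 1 ↔
    σ ∈ ({permOf ![0, 1, 2] ![0, 1, 2], permOf ![0, 2, 1] ![0, 2, 1],
      permOf ![1, 2, 0] ![2, 0, 1]} : Finset (Equiv.Perm (Fin 3))) := by
  decide

open Classical in
theorem sum_unshuffle_two_one {W : Type*} [AddCommGroup W] [Module ℝ W] (q : Fin 3 → ZMod 2)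
    (F : Fin 3 → Fin 3 → Fin 3 → W) :
    (∑ σ : Equiv.Perm (Fin 3), if LInftyData.IsUnshuffle (i := 2) (m := 1) σ then
      chi σ q • F (σ 0) (σ 1) (σ 2) else 0) =
    F 0 1 2 - sgn (q 2 * q 1) • F 0 2 1 + (sgn (q 1 * q 0) * sgn (q 2 * q 0)) • F 1 2 0 := by
  have hiff : ∀ σ : Equiv.Perm (Fin 3),
      LInftyData.IsUnshuffle (i := 2) (m := 1) σ ↔ σ 0 < σ 1 := fun σ => by
    have h : StrictMono fun b : Fin 1 => σ (Fin.natAdd 2 b) := Subsingleton.strictMono _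
    simp only [LInftyData.IsUnshuffle, Fin.strictMono_iff_lt_succ (n := 1), Fin.forall_fin_one, h,
      and_true]
    rfl
  simp only [hiff, isUnshuffle_two_one]
  rw [← Finset.sum_filter, Finset.filter_mem_eq_inter, Finset.univ_inter]
  rw [Finset.sum_insert (by decide), Finset.sum_insert (by decide), Finset.sum_singleton]
  have hp : ∀ (i : Fin 3) (f : Fin 3 → ℝ),
      ∏ a ∈ Finset.Iio i, f a = ∏ a, if a < i then f a else 1 := fun i f => by
    rw [← Finset.prod_filter]
    congr 1
    ext
    simp
  simp [chi_eq_prod, hp, Fin.prod_univ_succ, exchangeSign]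
  abel

open Classical in
-- Super-skew-symmetry turns the derivation form of the Jacobi identity into the cyclic one; the
-- leftover signs are squares.
theorem IsLieSuperalgebra.jacobi_unshuffle (hL : IsLieSuperalgebra G br) (q : Fin 3 → ZMod 2)
    (x : Fin 3 → L) (hx : ∀ a, x a ∈ G (q a)) :
    (∑ σ : Equiv.Perm (Fin 3), if LInftyData.IsUnshuffle (i := 2) (m := 1) σ then
      chi σ q • br (br (x (σ 0)) (x (σ 1))) (x (σ 2)) else 0) = 0 := by
  rw [sum_unshuffle_two_one q fun i j k => br (br (x i) (x j)) (x k)]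
  have hj := hL.jacobi _ _ _ _ (hx 0) _ (hx 1) _ (hx 2)
  have h₁ := hL.skew _ _ _ (hL.bracket_mem _ _ _ (hx 1) _ (hx 2)) _ (hx 0)
  have h₂ := hL.skew _ _ _ (hL.bracket_mem _ _ _ (hx 0) _ (hx 2)) _ (hx 1)
  rw [h₁, h₂, hj, add_mul, add_mul, sgn_add, sgn_add, mul_comm (q 0) (q 1)]
  have s₁ := sgn_mul_self (q 1 * q 0)
  have s₂ := sgn_mul_self (q 2 * q 0)
  have s₃ := sgn_mul_self (q 2 * q 1)
  generalize sgn (q 1 * q 0) = a at *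
  generalize sgn (q 2 * q 0) = b at *
  generalize sgn (q 2 * q 1) = c at *
  match_scalars
  · linear_combination -(b * b) * s₁ - s₂
  · linear_combination a * s₃ - a * a * a * s₂ - a * s₁

variable {ω : MultilinearMap ℝ (fun _ : Fin 4 => L) ℝ}

namespace LInftyData

theorem extension_l_two (x : Fin 2 → L × ℝ) :
    (extension G br ω).l 2 x = (br (x 0).1 (x 1).1, 0) := rfl

theorem extension_l_four (x : Fin 4 → L × ℝ) :
    (extension G br ω).l 4 x = (0, ω fun a => (x a).1) := rfl

theorem extension_l_of_ne {k : ℕ} (h₂ : k ≠ 2) (h₄ : k ≠ 4) : (extension G br ω).l k = 0 := by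
  match k, h₂, h₄ with
  | 0, _, _ => rfl
  | 1, _, _ => rfl
  | 3, _, _ => rfl
  | _ + 5, _, _ => rfl

theorem extension_l_eq_zero {k : ℕ} (x : Fin k → L × ℝ) (a : Fin k) (ha : (x a).1 = 0) :
    (extension G br ω).l k x = 0 := by
  by_cases h₂ : k = 2
  · subst h₂
    rw [extension_l_two]
    fin_cases a <;> simp_all
  by_cases h₄ : k = 4
  · subst h₄
    rw [extension_l_four, ω.map_coord_zero a ha]
    rfl
  rw [extension_l_of_ne h₂ h₄]
  rfl

theorem extension_grading_zero (q : ZMod 2) :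
    (extension G br ω).grading (0, q) = (G q).prod ⊥ := rfl

theorem extension_grading_two :
    (extension G br ω).grading (2, 0) = Submodule.prod ⊥ ⊤ := rfl

theorem extension_grading_of_ne {d : ℤ × ZMod 2} (h₀ : d.1 ≠ 0) (h₂ : d ≠ (2, 0)) :
    (extension G br ω).grading d = ⊥ :=
  (if_neg h₀).trans (if_neg h₂)

theorem fst_eq_zero_of_mem_extension {d : ℤ × ZMod 2} (hd : d.1 ≠ 0) {x : L × ℝ}
    (hx : x ∈ (extension G br ω).grading d) : x.1 = 0 := by
  by_cases h₂ : d = (2, 0)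
  · subst h₂
    rw [extension_grading_two] at hx
    exact hx.1
  · rw [extension_grading_of_ne hd h₂] at hx
    rw [(Submodule.mem_bot ℝ).mp hx]
    rfl

/-- Outside degree 0 the component in `L` vanishes and lies in every summand. The overall grade can
therefore serve as its parity, and the signs `chi` of the extension agree with those of `L`. -/
theorem fst_mem_of_mem_extension {d : ℤ × ZMod 2} {x : L × ℝ}
    (hx : x ∈ (extension G br ω).grading d) : x.1 ∈ G (grade d) := by
  obtain ⟨p, q⟩ := d
  by_cases h₀ : p = 0
  · subst h₀
    have : grade (0, q) = q := by simp [grade]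
    rw [this]
    exact hx.1
  · rw [fst_eq_zero_of_mem_extension h₀ hx]
    exact zero_mem _

theorem extension_isInternal (hG : DirectSum.IsInternal G) :
    DirectSum.IsInternal (extension G br ω).grading := by
  obtain ⟨π, h₁, h₂⟩ := exists_projections hG
  refine isInternal_of_projections (fun d => if d.1 = 0 then
      LinearMap.inl ℝ L ℝ ∘ₗ π d.2 ∘ₗ LinearMap.fst ℝ L ℝ else if d = (2, 0) then
      LinearMap.inr ℝ L ℝ ∘ₗ LinearMap.snd ℝ L ℝ else 0) ?_ ?_ ?_
  · rintro ⟨p, q⟩ x hx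
    by_cases h₀ : p = 0
    · subst h₀
      rw [extension_grading_zero] at hx
      have h : x.2 = 0 := hx.2
      ext <;> simp [h₁ q x.1 hx.1, h]
    · by_cases h₂ : (p, q) = (2, 0)
      · rw [h₂, extension_grading_two] at hx
        have h : x.1 = 0 := hx.1
        rw [h₂]
        ext <;> simp [h]
      · rw [extension_grading_of_ne h₀ h₂] at hx
        rw [(Submodule.mem_bot ℝ).mp hx, map_zero]
  · rintro ⟨p, q⟩ ⟨p', q'⟩ hne x hx
    by_cases h₀' : p' = 0
    · subst h₀'
      rw [extension_grading_zero] at hx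
      have h : x.2 = 0 := hx.2
      by_cases h₀ : p = 0
      · subst h₀
        have hq : q' ≠ q := fun h => hne (by rw [h])
        ext <;> simp [h₂ q q' hq x.1 hx.1]
      · ext <;> simp only [h₀, if_false] <;> split_ifs <;> simp [h]
    · have h : x.1 = 0 := fst_eq_zero_of_mem_extension h₀' hx
      by_cases h₀ : p = 0
      · subst h₀
        ext <;> simp [h]
      · by_cases h₂' : (p', q') = (2, 0)
        · have : (p, q) ≠ (2, 0) := fun h => hne (h₂'.trans h.symm)
          simp [h₀, this]
        · rw [extension_grading_of_ne h₀' h₂'] at hx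
          rw [(Submodule.mem_bot ℝ).mp hx, map_zero]
  · intro x
    have hx : x = LinearMap.inl ℝ L ℝ x.1 + LinearMap.inr ℝ L ℝ x.2 := by ext <;> simp
    rw [hx]
    refine add_mem ?_ ?_
    · have hle : ⨆ q, G q ≤ (⨆ d, (extension G br ω).grading d).comap (LinearMap.inl ℝ L ℝ) :=
        iSup_le fun q y hy => Submodule.mem_iSup_of_mem (0, q) ⟨hy, rfl⟩
      exact hle (hG.submodule_iSup_eq_top ▸ Submodule.mem_top)
    · exact Submodule.mem_iSup_of_mem (2, 0) ⟨rfl, trivial⟩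

open Classical in
/-- The cocycle condition as a sum over unshuffles. -/
theorem cocycle_unshuffle (hω : IsEvenCocycle G (evenGrading ℝ) (fun x y => br x y)
    (fun _ _ => 0) ω) (q : Fin 5 → ZMod 2) (x : Fin 5 → L) (hx : ∀ a, x a ∈ G (q a)) :
    (∑ σ : Equiv.Perm (Fin 5), if IsUnshuffle (i := 2) (m := 3) σ then
      chi σ q * ω ![br (x (σ 0)) (x (σ 1)), x (σ 2), x (σ 3), x (σ 4)] else 0) = 0 := by
  have h := hω.2 q x hx
  rw [coboundary_four, neg_eq_zero] at h
  exact (sum_unshuffle_two_three q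
    fun i j k l m => ω ![br (x i) (x j), x k, x l, x m]).trans h

/-- An inner bracket other than `l 2` has zero component in `L`, and every outer bracket kills such
an element. With `l 2` inside, the outer bracket must be `l 2` or `l 4`, giving the Jacobi identity
and the cocycle condition. -/
theorem extension_jacobiTerm (hL : IsLieSuperalgebra G br)
    (hω : IsEvenCocycle G (evenGrading ℝ) (fun x y => br x y) (fun _ _ => 0) ω) (i m : ℕ)
    (d : Fin (i + m) → ℤ × ZMod 2) (x : Fin (i + m) → L × ℝ)
    (hx : ∀ a, x a ∈ (extension G br ω).grading (d a)) :
    (extension G br ω).jacobiTerm i m d x = 0 := by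
  classical
  by_cases hi : i = 2
  · subst hi
    have hx' := fun a => fst_mem_of_mem_extension (hx a)
    by_cases hm₁ : m = 1
    · subst hm₁
      have h := congrArg (LinearMap.inl ℝ L ℝ) (hL.jacobi_unshuffle _ _ hx')
      rw [map_sum, map_zero] at h
      rw [← h, jacobiTerm]
      refine Finset.sum_congr rfl fun σ _ => ?_
      split_ifs
      · rw [map_smul, (by norm_num : (-1 : ℝ) ^ (2 * 1) = 1), mul_one]
        rfl
      · rw [map_zero]
    by_cases hm₃ : m = 3
    · subst hm₃
      have h := congrArg (LinearMap.inr ℝ L ℝ) (cocycle_unshuffle hω _ _ hx')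
      rw [map_sum, map_zero] at h
      rw [← h, jacobiTerm]
      refine Finset.sum_congr rfl fun σ _ => ?_
      split_ifs
      · rw [extension_l_four, (by norm_num : (-1 : ℝ) ^ (2 * 3) = 1), mul_one,
          ← smul_eq_mul (chi _ _) (ω _), map_smul]
        refine congrArg (fun r : ℝ => chi σ _ • ((0, r) : L × ℝ)) (congrArg ω (funext fun a => ?_))
        fin_cases a <;> rfl
      · rw [map_zero]
    refine Finset.sum_eq_zero fun σ _ => ?_
    rw [extension_l_of_ne (by omega) (by omega)]
    simp
  · refine Finset.sum_eq_zero fun σ _ => ?_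
    rw [extension_l_eq_zero _ 0, smul_zero, ite_self]
    rw [Fin.cons_zero]
    by_cases hi₄ : i = 4
    · subst hi₄
      rfl
    · rw [extension_l_of_ne hi hi₄]
      rfl

/-- The extension of a Lie superalgebra by an even 4-cocycle is a Lie 3-superalgebra. -/
theorem extension_isLieNSuperalgebra (hL : IsLieSuperalgebra G br)
    (hω : IsEvenCocycle G (evenGrading ℝ) (fun x y => br x y) (fun _ _ => 0) ω) :
    IsLieNSuperalgebra 3 (extension G br ω) where
  left :=
    { internal := extension_isInternal hL.internal
      nonneg := fun p q hp =>
        extension_grading_of_ne hp.ne fun h => by simp [Prod.ext_iff] at h; omega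
      l_zero := rfl
      degree := fun k d x hx => by
        by_cases hd : ∀ a, (d a).1 = 0
        · have hx' : ∀ a, (x a).1 ∈ G (d a).2 := fun a => by
            have h := hx a
            rw [← Prod.mk.eta (p := d a), hd a] at h
            exact h.1
          rw [Finset.sum_eq_zero fun a _ => hd a, zero_add]
          by_cases h₂ : k = 2
          · subst h₂
            rw [extension_l_two, Fin.sum_univ_two]
            exact ⟨hL.bracket_mem _ _ _ (hx' 0) _ (hx' 1), rfl⟩
          by_cases h₄ : k = 4
          · subst h₄
            have h := hω.1.parity _ _ hx'
            rw [zero_add] at h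
            rw [extension_l_four]
            -- The degree is 4 - 2 = 2, where only even parity is nonzero; for odd total parity the
            -- even cochain vanishes.
            norm_num
            generalize ∑ a, (d a).2 = s at h
            by_cases hs : s = 0
            · subst hs
              exact ⟨rfl, trivial⟩
            · simp only [evenGrading, hs, if_false, Submodule.mem_bot] at h
              rw [h]
              exact zero_mem _
          rw [extension_l_of_ne h₂ h₄]
          exact zero_mem _
        · push Not at hd
          obtain ⟨a, ha⟩ := hd
          rw [extension_l_eq_zero x a (fst_eq_zero_of_mem_extension ha (hx a))]
          exact zero_mem _
      antisymm := fun k d x hx σ => by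
        have hx' := fun a => fst_mem_of_mem_extension (hx a)
        by_cases h₂ : k = 2
        · subst h₂
          exact (congrArg (LinearMap.inl ℝ L ℝ) (hL.skew_perm _ _ hx' σ)).trans (map_smul _ _ _)
        by_cases h₄ : k = 4
        · subst h₄
          exact (congrArg (LinearMap.inr ℝ L ℝ) (hω.1.skew _ _ hx' σ)).trans (map_smul _ _ _)
        rw [extension_l_of_ne h₂ h₄]
        simp
      jacobi := fun n d x hx => Finset.sum_eq_zero fun c _ =>
        extension_jacobiTerm hL hω _ _ _ _ fun a => hx _ }
  right := fun p q hp => extension_grading_of_ne (by simp; omega) fun h => by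
    simp [Prod.ext_iff] at h
    omega

end LInftyData

end Extension

section ShortExact

variable {L : Type} [AddCommGroup L] [Module ℝ L] {G : ZMod 2 → Submodule ℝ L}
  {br : L →ₗ[ℝ] L →ₗ[ℝ] L} {ω : MultilinearMap ℝ (fun _ : Fin 4 => L) ℝ}

namespace LInftyData

theorem ofLie_l_of_ne {k : ℕ} (h₂ : k ≠ 2) : (ofLie G br).l k = 0 := by
  match k, h₂ with
  | 0, _ => rfl
  | 1, _ => rfl
  | _ + 3, _ => rfl

theorem mem_of_mem_ofLie {d : ℤ × ZMod 2} {x : L} (hx : x ∈ (ofLie G br).grading d) :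
    x ∈ G (grade d) := by
  obtain ⟨p, q⟩ := d
  by_cases h₀ : p = 0
  · subst h₀
    have : grade (0, q) = q := by simp [grade]
    rw [this]
    exact hx
  · simp only [ofLie, h₀, if_false, Submodule.mem_bot] at hx
    rw [hx]
    exact zero_mem _

theorem ofLie_isInternal (hG : DirectSum.IsInternal G) :
    DirectSum.IsInternal (ofLie G br).grading := by
  obtain ⟨π, h₁, h₂⟩ := exists_projections hG
  refine isInternal_of_projections (fun d => if d.1 = 0 then π d.2 else 0) ?_ ?_ fun x => ?_
  · rintro ⟨p, q⟩ x hx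
    by_cases h₀ : p = 0
    · subst h₀
      exact h₁ q x hx
    · simp only [ofLie, h₀, if_false, Submodule.mem_bot] at hx
      rw [hx, map_zero]
  · rintro ⟨p, q⟩ ⟨p', q'⟩ hne x hx
    by_cases h₀' : p' = 0
    · subst h₀'
      by_cases h₀ : p = 0
      · subst h₀
        exact h₂ q q' (fun h => hne (by rw [h])) x hx
      · simp [h₀]
    · simp only [ofLie, h₀', if_false, Submodule.mem_bot] at hx
      rw [hx, map_zero]
  · have hle : ⨆ q, G q ≤ ⨆ d, (ofLie G br).grading d :=
      iSup_le fun q y hy => Submodule.mem_iSup_of_mem (0, q) hy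
    exact hle (hG.submodule_iSup_eq_top ▸ Submodule.mem_top)

theorem ofLie_jacobiTerm (hL : IsLieSuperalgebra G br) (i m : ℕ)
    (d : Fin (i + m) → ℤ × ZMod 2) (x : Fin (i + m) → L)
    (hx : ∀ a, x a ∈ (ofLie G br).grading (d a)) :
    (ofLie G br).jacobiTerm i m d x = 0 := by
  classical
  by_cases hi : i = 2
  · subst hi
    by_cases hm : m = 1
    · subst hm
      rw [← hL.jacobi_unshuffle _ _ fun a => mem_of_mem_ofLie (hx a), jacobiTerm]
      refine Finset.sum_congr rfl fun σ _ => ?_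
      rw [(by norm_num : (-1 : ℝ) ^ (2 * 1) = 1), mul_one]
      rfl
    · refine Finset.sum_eq_zero fun σ _ => ?_
      rw [ofLie_l_of_ne (by omega)]
      simp
  · refine Finset.sum_eq_zero fun σ _ => ?_
    rw [ofLie_l_of_ne hi, ((ofLie G br).l (m + 1)).map_coord_zero 0 rfl, smul_zero, ite_self]

theorem ofLie_isLInftySuperalgebra (hL : IsLieSuperalgebra G br) :
    IsLInftySuperalgebra (ofLie G br) where
  internal := ofLie_isInternal hL.internal
  nonneg p q hp := if_neg hp.ne
  l_zero := rfl
  degree k d x hx := by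
    by_cases h₂ : k = 2
    · subst h₂
      by_cases hd : ∀ a, (d a).1 = 0
      · have hx' : ∀ a, x a ∈ G (d a).2 := fun a => by
          have h := hx a
          rw [← Prod.mk.eta (p := d a), hd a] at h
          exact h
        rw [Finset.sum_eq_zero fun a _ => hd a, zero_add, Fin.sum_univ_two]
        exact hL.bracket_mem _ _ _ (hx' 0) _ (hx' 1)
      · push Not at hd
        obtain ⟨a, ha⟩ := hd
        have h := hx a
        simp only [ofLie, ha, if_false, Submodule.mem_bot] at h
        rw [((ofLie G br).l 2).map_coord_zero a h]
        exact zero_mem _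
    · rw [ofLie_l_of_ne h₂]
      exact zero_mem _
  antisymm k d x hx σ := by
    by_cases h₂ : k = 2
    · subst h₂
      exact hL.skew_perm _ _ (fun a => mem_of_mem_ofLie (hx a)) σ
    · rw [ofLie_l_of_ne h₂]
      simp
  jacobi n d x hx := Finset.sum_eq_zero fun c _ => ofLie_jacobiTerm hL _ _ _ _ fun a => hx _

theorem bTwoR_isLInftySuperalgebra : IsLInftySuperalgebra bTwoR where
  internal := by
    refine isInternal_of_projections (fun d => if d = (2, 0) then LinearMap.id else 0) ?_ ?_
      fun x => ?_
    · intro d x hx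
      by_cases h : d = (2, 0)
      · simp [h]
      · simp only [bTwoR, h, if_false, Submodule.mem_bot] at hx
        rw [hx, map_zero]
    · intro d d' hne x hx
      by_cases h : d' = (2, 0)
      · simp [h ▸ hne.symm]
      · simp only [bTwoR, h, if_false, Submodule.mem_bot] at hx
        rw [hx, map_zero]
    · exact Submodule.mem_iSup_of_mem (2, 0) trivial
  nonneg p q hp := if_neg fun h => by
    simp [Prod.ext_iff] at h
    omega
  l_zero := rfl
  degree _ _ _ _ := zero_mem _
  antisymm k d x hx σ := (smul_zero _).symm
  jacobi n d x hx := Finset.sum_eq_zero fun c _ => Finset.sum_eq_zero fun σ _ => by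
    simp [bTwoR]

theorem extension_isShortExact (hL : IsLieSuperalgebra G br)
    (hω : IsEvenCocycle G (evenGrading ℝ) (fun x y => br x y) (fun _ _ => 0) ω) :
    IsShortExact bTwoR (extension G br ω) (ofLie G br) (LinearMap.inr ℝ L ℝ)
      (LinearMap.fst ℝ L ℝ) where
  left := bTwoR_isLInftySuperalgebra
  middle := (extension_isLieNSuperalgebra hL hω).1
  right := ofLie_isLInftySuperalgebra hL
  hom_left := by
    refine ⟨fun d x hx => ?_, fun k x => ?_⟩
    · by_cases h : d = (2, 0)
      · subst h
        exact ⟨rfl, trivial⟩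
      · simp only [bTwoR, h, if_false, Submodule.mem_bot] at hx
        rw [hx, map_zero]
        exact zero_mem _
    · rcases Nat.eq_zero_or_pos k with rfl | hk
      · rfl
      · rw [extension_l_eq_zero _ ⟨0, hk⟩ rfl]
        exact map_zero _
  hom_right := by
    refine ⟨fun d x hx => ?_, fun k x => ?_⟩
    · by_cases h : d.1 = 0
      · rw [← Prod.mk.eta (p := d), h] at hx ⊢
        exact hx.1
      · rw [LinearMap.fst_apply, fst_eq_zero_of_mem_extension h hx]
        exact zero_mem _
    · by_cases h₂ : k = 2
      · subst h₂
        rfl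
      · rw [ofLie_l_of_ne h₂]
        by_cases h₄ : k = 4
        · subst h₄
          rfl
        · rw [extension_l_of_ne h₂ h₄]
          rfl
  injective := LinearMap.inr_injective
  exact := fun x => by
    constructor
    · intro h
      exact ⟨x.2, Prod.ext h.symm rfl⟩
    · rintro ⟨r, rfl⟩
      rfl
  surjective := LinearMap.fst_surjective

/-- An extension is exact only if its cocycle is a coboundary. -/
theorem isCoboundary_of_isExact (h : IsExact 2 (extension G br ω)) :
    IsCoboundary G (evenGrading ℝ) (fun x y => br x y) (fun _ _ => 0) ω := by
  obtain ⟨θ, hθ, h⟩ := h.2.2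
  -- Each cochain is restricted to `L` in its arguments and projected to ℝ in its values.
  refine ⟨fun p => (LinearMap.snd ℝ L ℝ).compMultilinearMap
    ((θ p).compLinearMap fun _ => LinearMap.inl ℝ L ℝ), fun p => ⟨?_, ?_⟩, ?_⟩
  · intro q x hx
    have hm := (hθ p).parity q (fun a => (x a, 0)) fun a => ⟨hx a, rfl⟩
    by_cases hs : p + ∑ i, q i = 0
    · rw [hs]
      trivial
    · rw [extension_grading_of_ne (by simp) (by simp [hs])] at hm
      simp only [evenGrading, hs, if_false, Submodule.mem_bot]
      exact congrArg Prod.snd ((Submodule.mem_bot ℝ).mp hm)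
  · intro q x hx σ
    exact congrArg Prod.snd ((hθ p).skew q (fun a => (x a, 0)) (fun a => ⟨hx a, rfl⟩) σ)
  · intro q X hX
    have h' := congrArg Prod.snd (h q (fun a => (X a, 0)) fun a => ⟨hX a, rfl⟩)
    refine h'.trans ?_
    rw [Prod.snd_sum]
    refine Finset.sum_congr rfl fun p _ => ?_
    rw [coboundary, coboundary, Prod.snd_add, Prod.snd_sum, Prod.snd_sum]
    -- The action terms agree by definition: `l 2` has no component in ℝ.
    congr 1
    refine Finset.sum_congr rfl fun j _ => ?_
    rw [Prod.snd_sum]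
    refine Finset.sum_congr rfl fun i _ => ?_
    split_ifs
    · rw [Prod.smul_snd]
      congr 1
      refine congrArg (fun y => (θ p y).2) (funext fun a => ?_)
      refine Fin.cases ?_ (fun a => ?_) a <;> rfl
    · rfl

end LInftyData

/-- With trivial coefficients, a cocycle that does not vanish at commuting elements is not a
coboundary. -/
theorem not_isCoboundary_of_commuting {n : ℕ} {ω : MultilinearMap ℝ (fun _ : Fin (n + 2) => L) ℝ}
    (q : Fin (n + 2) → ZMod 2) (X : Fin (n + 2) → L) (hX : ∀ i, X i ∈ G (q i))
    (hbr : ∀ i j, i < j → br (X i) (X j) = 0) (hω : ω X ≠ 0) :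
    ¬ IsCoboundary G (evenGrading ℝ) (fun x y => br x y) (fun _ _ => 0) ω := by
  rintro ⟨θ, -, h⟩
  refine hω ((h q X hX).trans (Finset.sum_eq_zero fun p _ => ?_))
  simp only [coboundary, smul_zero, Finset.sum_const_zero, zero_add]
  refine Finset.sum_eq_zero fun j _ => Finset.sum_eq_zero fun i _ => ?_
  split_ifs with hij
  · rw [(θ p).map_coord_zero 0 (hbr _ _ hij), smul_zero]
  · rfl

end ShortExact

/-! ## The Poincaré superalgebra -/

section Poincare

variable {K : Type} [NormedDivisionAlgebra K]

theorem zmod_two_cases (a : ZMod 2) : a = 0 ∨ a = 1 := by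
  revert a
  decide

theorem mem_sisoGrading_zero {x : Siso K} (hx : x ∈ sisoGrading K 0) :
    ∃ (X : so K) (A : Vec K), x = (X, A, 0) :=
  ⟨x.1, x.2.1, Prod.ext rfl (Prod.ext rfl hx.2.2)⟩

theorem mem_sisoGrading_one {x : Siso K} (hx : x ∈ sisoGrading K 1) :
    ∃ Ψ : Spinor K, x = (0, 0, Ψ) :=
  ⟨x.2.2, Prod.ext hx.1 (Prod.ext hx.2.1 rfl)⟩

theorem even_mem (X : so K) (A : Vec K) : ((X, A, 0) : Siso K) ∈ sisoGrading K 0 :=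
  ⟨trivial, trivial, rfl⟩

theorem odd_mem (Ψ : Spinor K) : ((0, 0, Ψ) : Siso K) ∈ sisoGrading K 1 :=
  ⟨rfl, rfl, trivial⟩

theorem sisoBracket_apply (x y : Siso K) : sisoBracket K x y = (soBracket K x.1 y.1,
    x.1.1 y.2.1 - y.1.1 x.2.1 + dot K x.2.2 y.2.2, spin K x.1 y.2.2 - spin K y.1 x.2.2) :=
  Prod.ext rfl (Prod.ext rfl (add_zero _))

theorem sisoBracket_even_even (X Y : so K) (A C : Vec K) :
    sisoBracket K (X, A, 0) (Y, C, 0) = (soBracket K X Y, X.1 C - Y.1 A, 0) := by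
  simp [sisoBracket_apply]

theorem sisoBracket_even_odd (X : so K) (A : Vec K) (Ψ : Spinor K) :
    sisoBracket K (X, A, 0) (0, 0, Ψ) = (0, 0, spin K X Ψ) := by
  simp [sisoBracket_apply]

theorem sisoBracket_odd_even (X : so K) (A : Vec K) (Ψ : Spinor K) :
    sisoBracket K (0, 0, Ψ) (X, A, 0) = (0, 0, -spin K X Ψ) := by
  simp [sisoBracket_apply]

theorem sisoBracket_odd_odd (Ψ Φ : Spinor K) :
    sisoBracket K (0, 0, Ψ) (0, 0, Φ) = (0, dot K Ψ Φ, 0) := by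
  simp [sisoBracket_apply]

theorem soBracket_skew (X Y : so K) : soBracket K X Y = -soBracket K Y X :=
  Subtype.ext (neg_sub _ _).symm

theorem commutator_jacobi {R : Type*} [Ring R] (a b c : R) : a * (b * c - c * b) -
    (b * c - c * b) * a = (a * b - b * a) * c - c * (a * b - b * a) +
      (b * (a * c - c * a) - (a * c - c * a) * b) := by
  noncomm_ring

theorem soBracket_jacobi (X Y Z : so K) : soBracket K X (soBracket K Y Z) =
    soBracket K (soBracket K X Y) Z + soBracket K Y (soBracket K X Z) :=
  Subtype.ext (commutator_jacobi X.1 Y.1 Z.1)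

theorem soBracket_apply (X Y : so K) (A : Vec K) :
    (soBracket K X Y).1 A = X.1 (Y.1 A) - Y.1 (X.1 A) := rfl

theorem spin_bracket_apply (X Y : so K) (Ψ : Spinor K) :
    spin K (soBracket K X Y) Ψ = spin K X (spin K Y Ψ) - spin K Y (spin K X Ψ) := by
  rw [spin_bracket]
  rfl

theorem sisoGrading_isInternal : DirectSum.IsInternal (sisoGrading K) := by
  refine isInternal_of_projections (fun q => if q = 0 then
    (LinearMap.inl ℝ (so K) (T K) ∘ₗ LinearMap.fst ℝ (so K) (T K) +
      LinearMap.inr ℝ (so K) (T K) ∘ₗ LinearMap.inl ℝ (Vec K) (Spinor K) ∘ₗ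
        LinearMap.fst ℝ (Vec K) (Spinor K) ∘ₗ LinearMap.snd ℝ (so K) (T K)) else
    LinearMap.inr ℝ (so K) (T K) ∘ₗ LinearMap.inr ℝ (Vec K) (Spinor K) ∘ₗ
      LinearMap.snd ℝ (Vec K) (Spinor K) ∘ₗ LinearMap.snd ℝ (so K) (T K)) ?_ ?_ ?_
  · intro q x hx
    rcases zmod_two_cases q with rfl | rfl
    · obtain ⟨X, A, rfl⟩ := mem_sisoGrading_zero hx
      simp
    · obtain ⟨Ψ, rfl⟩ := mem_sisoGrading_one hx
      simp
  · intro q q' hne x hx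
    rcases zmod_two_cases q with rfl | rfl <;> rcases zmod_two_cases q' with rfl | rfl
    · exact absurd rfl hne
    · obtain ⟨Ψ, rfl⟩ := mem_sisoGrading_one hx
      simp
    · obtain ⟨X, A, rfl⟩ := mem_sisoGrading_zero hx
      simp
    · exact absurd rfl hne
  · rintro ⟨X, A, Ψ⟩
    have h : ((X, A, Ψ) : Siso K) = (X, A, 0) + (0, 0, Ψ) := by simp
    rw [h]
    exact add_mem (Submodule.mem_iSup_of_mem 0 (even_mem X A))
      (Submodule.mem_iSup_of_mem 1 (odd_mem Ψ))

/-- The Jacobi identity, sorted by the number of spinors: none is the semidirect product with the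
vectors, one is `spin_bracket`, two is `so_dot`, and with three every double bracket is zero. -/
theorem siso_isLieSuperalgebra : IsLieSuperalgebra (sisoGrading K) (sisoBracket K) where
  internal := sisoGrading_isInternal
  bracket_mem p q x hx y hy := by
    have h₂ : (1 + 1 : ZMod 2) = 0 := by decide
    rcases zmod_two_cases p with rfl | rfl <;> rcases zmod_two_cases q with rfl | rfl
    · obtain ⟨X, A, rfl⟩ := mem_sisoGrading_zero hx
      obtain ⟨Y, C, rfl⟩ := mem_sisoGrading_zero hy
      rw [sisoBracket_even_even]
      exact even_mem _ _
    · obtain ⟨X, A, rfl⟩ := mem_sisoGrading_zero hx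
      obtain ⟨Φ, rfl⟩ := mem_sisoGrading_one hy
      rw [sisoBracket_even_odd]
      exact odd_mem _
    · obtain ⟨Ψ, rfl⟩ := mem_sisoGrading_one hx
      obtain ⟨Y, C, rfl⟩ := mem_sisoGrading_zero hy
      rw [sisoBracket_odd_even]
      exact odd_mem _
    · obtain ⟨Ψ, rfl⟩ := mem_sisoGrading_one hx
      obtain ⟨Φ, rfl⟩ := mem_sisoGrading_one hy
      rw [sisoBracket_odd_odd, h₂]
      exact even_mem _ _
  skew p q x hx y hy := by
    rcases zmod_two_cases p with rfl | rfl <;> rcases zmod_two_cases q with rfl | rfl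
    · obtain ⟨X, A, rfl⟩ := mem_sisoGrading_zero hx
      obtain ⟨Y, C, rfl⟩ := mem_sisoGrading_zero hy
      simp [sisoBracket_even_even, sgn_zero, ← soBracket_skew]
    · obtain ⟨X, A, rfl⟩ := mem_sisoGrading_zero hx
      obtain ⟨Φ, rfl⟩ := mem_sisoGrading_one hy
      simp [sisoBracket_even_odd, sisoBracket_odd_even, sgn_zero]
    · obtain ⟨Ψ, rfl⟩ := mem_sisoGrading_one hx
      obtain ⟨Y, C, rfl⟩ := mem_sisoGrading_zero hy
      simp [sisoBracket_even_odd, sisoBracket_odd_even, sgn_zero]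
    · obtain ⟨Ψ, rfl⟩ := mem_sisoGrading_one hx
      obtain ⟨Φ, rfl⟩ := mem_sisoGrading_one hy
      simp [sisoBracket_odd_odd, sgn_one, dot_comm Φ Ψ]
  jacobi p q r x hx y hy z hz := by
    rcases zmod_two_cases p with rfl | rfl <;> rcases zmod_two_cases q with rfl | rfl <;>
      rcases zmod_two_cases r with rfl | rfl
    · obtain ⟨X, A, rfl⟩ := mem_sisoGrading_zero hx
      obtain ⟨Y, C, rfl⟩ := mem_sisoGrading_zero hy
      obtain ⟨Z, D, rfl⟩ := mem_sisoGrading_zero hz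
      simp [sisoBracket_even_even, sgn_zero, soBracket_jacobi X, soBracket_apply]
      abel
    · obtain ⟨X, A, rfl⟩ := mem_sisoGrading_zero hx
      obtain ⟨Y, C, rfl⟩ := mem_sisoGrading_zero hy
      obtain ⟨Θ, rfl⟩ := mem_sisoGrading_one hz
      simp [sisoBracket_even_even, sisoBracket_even_odd, sgn_zero, spin_bracket_apply]
    · obtain ⟨X, A, rfl⟩ := mem_sisoGrading_zero hx
      obtain ⟨Φ, rfl⟩ := mem_sisoGrading_one hy
      obtain ⟨Z, D, rfl⟩ := mem_sisoGrading_zero hz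
      simp [sisoBracket_even_even, sisoBracket_even_odd, sisoBracket_odd_even, sgn_zero,
        spin_bracket_apply]
      abel
    · obtain ⟨X, A, rfl⟩ := mem_sisoGrading_zero hx
      obtain ⟨Φ, rfl⟩ := mem_sisoGrading_one hy
      obtain ⟨Θ, rfl⟩ := mem_sisoGrading_one hz
      simp [sisoBracket_even_even, sisoBracket_even_odd, sisoBracket_odd_odd, sgn_zero, so_dot]
    · obtain ⟨Ψ, rfl⟩ := mem_sisoGrading_one hx
      obtain ⟨Y, C, rfl⟩ := mem_sisoGrading_zero hy
      obtain ⟨Z, D, rfl⟩ := mem_sisoGrading_zero hz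
      simp [sisoBracket_even_even, sisoBracket_even_odd, sisoBracket_odd_even, sgn_zero,
        spin_bracket_apply]
      abel
    · obtain ⟨Ψ, rfl⟩ := mem_sisoGrading_one hx
      obtain ⟨Y, C, rfl⟩ := mem_sisoGrading_zero hy
      obtain ⟨Θ, rfl⟩ := mem_sisoGrading_one hz
      simp [sisoBracket_even_even, sisoBracket_even_odd, sisoBracket_odd_even,
        sisoBracket_odd_odd, sgn_zero, so_dot]
    · obtain ⟨Ψ, rfl⟩ := mem_sisoGrading_one hx
      obtain ⟨Φ, rfl⟩ := mem_sisoGrading_one hy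
      obtain ⟨Z, D, rfl⟩ := mem_sisoGrading_zero hz
      simp [sisoBracket_even_even, sisoBracket_odd_even, sisoBracket_odd_odd, sgn_one, so_dot,
        dot_comm Φ]
    · obtain ⟨Ψ, rfl⟩ := mem_sisoGrading_one hx
      obtain ⟨Φ, rfl⟩ := mem_sisoGrading_one hy
      obtain ⟨Θ, rfl⟩ := mem_sisoGrading_one hz
      simp [sisoBracket_even_odd, sisoBracket_odd_even, sisoBracket_odd_odd]

/-! ## The cocycle -/

theorem betaSiso_eq (x : Fin 4 → Siso K) :
    betaSiso K x = bi (x 0).2.2 (x 1).2.2 (x 2).2.1 (x 3).2.1 -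
      bi (x 0).2.2 (x 2).2.2 (x 1).2.1 (x 3).2.1 + bi (x 0).2.2 (x 3).2.2 (x 1).2.1 (x 2).2.1 +
      bi (x 1).2.2 (x 2).2.2 (x 0).2.1 (x 3).2.1 - bi (x 1).2.2 (x 3).2.2 (x 0).2.1 (x 2).2.1 +
      bi (x 2).2.2 (x 3).2.2 (x 0).2.1 (x 1).2.1 :=
  beta_eq _

/-- For neighbours of equal parity this is the symmetry of `bi` in its spinors or its skewness in
its vectors; for mixed parity the swap exchanges terms of the unshuffle sum. -/
theorem betaSiso_swap (i : Fin 3) (q : Fin 4 → ZMod 2) (x : Fin 4 → Siso K)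
    (hx : ∀ a, x a ∈ sisoGrading K (q a)) :
    betaSiso K (fun a => x (Equiv.swap i.castSucc i.succ a)) =
      -(sgn (q i.castSucc * q i.succ) • betaSiso K x) := by
  have key : ∀ i : Fin 4, (q i = 0 ∧ (x i).2.2 = 0) ∨ (q i = 1 ∧ (x i).2.1 = 0) := fun i => by
    have h := hx i
    rcases zmod_two_cases (q i) with hq | hq <;> rw [hq] at h
    · exact .inl ⟨hq, h.2.2⟩
    · exact .inr ⟨hq, h.2.1⟩
  rw [betaSiso_eq, betaSiso_eq]
  have w₀ : Equiv.swap (0 : Fin 4) 1 2 = 2 ∧ Equiv.swap (0 : Fin 4) 1 3 = 3 := by decide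
  have w₁ : Equiv.swap (1 : Fin 4) 2 0 = 0 ∧ Equiv.swap (1 : Fin 4) 2 3 = 3 := by decide
  have w₂ : Equiv.swap (2 : Fin 4) 3 0 = 0 ∧ Equiv.swap (2 : Fin 4) 3 1 = 1 := by decide
  fin_cases i
  · rcases key 0 with ⟨h₀, e₀⟩ | ⟨h₀, e₀⟩ <;> rcases key 1 with ⟨h₁, e₁⟩ | ⟨h₁, e₁⟩ <;>
      simp [w₀, h₀, h₁, e₀, e₁, sgn_zero, sgn_one, bi_zero₁, bi_zero₂, bi_zero₃, bi_zero₄,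
        bi_comm (x 1).2.2 (x 0).2.2, bi_skew _ _ (x 1).2.1 (x 0).2.1] <;> ring
  · rcases key 1 with ⟨h₀, e₀⟩ | ⟨h₀, e₀⟩ <;> rcases key 2 with ⟨h₁, e₁⟩ | ⟨h₁, e₁⟩ <;>
      simp [w₁, h₀, h₁, e₀, e₁, sgn_zero, sgn_one, bi_zero₁, bi_zero₂, bi_zero₃, bi_zero₄,
        bi_comm (x 2).2.2 (x 1).2.2, bi_skew _ _ (x 2).2.1 (x 1).2.1] <;> ring
  · rcases key 2 with ⟨h₀, e₀⟩ | ⟨h₀, e₀⟩ <;> rcases key 3 with ⟨h₁, e₁⟩ | ⟨h₁, e₁⟩ <;>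
      simp [w₂, h₀, h₁, e₀, e₁, sgn_zero, sgn_one, bi_zero₁, bi_zero₂, bi_zero₃, bi_zero₄,
        bi_comm (x 3).2.2 (x 2).2.2, bi_skew _ _ (x 3).2.1 (x 2).2.1] <;> ring

theorem betaSiso_isCochain : IsCochain (sisoGrading K) (evenGrading ℝ) 0 (betaSiso K) where
  parity q x hx := by
    have key : ∀ i : Fin 4, (q i = 0 ∧ (x i).2.2 = 0) ∨ (q i = 1 ∧ (x i).2.1 = 0) := fun i => by
      have h := hx i
      rcases zmod_two_cases (q i) with hq | hq <;> rw [hq] at h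
      · exact .inl ⟨hq, h.2.2⟩
      · exact .inr ⟨hq, h.2.1⟩
    by_cases hs : 0 + ∑ i, q i = 0
    · rw [hs]
      trivial
    · simp only [evenGrading, hs, if_false, Submodule.mem_bot]
      rw [betaSiso_eq]
      rw [zero_add, Fin.sum_univ_four] at hs
      rcases key 0 with ⟨h₀, e₀⟩ | ⟨h₀, e₀⟩ <;> rcases key 1 with ⟨h₁, e₁⟩ | ⟨h₁, e₁⟩ <;>
        rcases key 2 with ⟨h₂, e₂⟩ | ⟨h₂, e₂⟩ <;> rcases key 3 with ⟨h₃, e₃⟩ | ⟨h₃, e₃⟩ <;>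
        rw [h₀, h₁, h₂, h₃] at hs <;> first
        | exact absurd (by decide) hs
        | simp [e₀, e₁, e₂, e₃, bi_zero₁, bi_zero₂, bi_zero₃, bi_zero₄]
  skew q x hx σ := skew_of_adjacent (sisoGrading K) (betaSiso K) betaSiso_swap q x hx σ

end Poincare

/-! ### The cocycle condition for β -/

section Cocycle

variable {K : Type} [NormedDivisionAlgebra K]

/-- Of the 32 parity patterns, 17 vanish term by term. In the ten with three even entries the terms
group by the Lorentz component that acts, giving three instances of invariance; the five with one
even entry are the spinor identity. -/
theorem betaSiso_pairSum (q : Fin 5 → ZMod 2) (X : Fin 5 → Siso K)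
    (hX : ∀ i, X i ∈ sisoGrading K (q i)) :
    pairSum q (fun i j k l m =>
      betaSiso K ![sisoBracket K (X i) (X j), X k, X l, X m]) = 0 := by
  have key : ∀ i : Fin 5, (q i = 0 ∧ ∃ (Y : so K) (A : Vec K), X i = (Y, A, 0)) ∨
      (q i = 1 ∧ ∃ Ψ : Spinor K, X i = (0, 0, Ψ)) := fun i => by
    have h := hX i
    rcases zmod_two_cases (q i) with hq | hq <;> rw [hq] at h
    · exact .inl ⟨hq, mem_sisoGrading_zero h⟩
    · exact .inr ⟨hq, mem_sisoGrading_one h⟩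
  have hcons : ∀ a b c d : Siso K, betaSiso K ![a, b, c, d] =
      bi a.2.2 b.2.2 c.2.1 d.2.1 - bi a.2.2 c.2.2 b.2.1 d.2.1 + bi a.2.2 d.2.2 b.2.1 c.2.1 +
      bi b.2.2 c.2.2 a.2.1 d.2.1 - bi b.2.2 d.2.2 a.2.1 c.2.1 + bi c.2.2 d.2.2 a.2.1 b.2.1 :=
    fun a b c d => betaSiso_eq _
  rw [pairSum]
  rcases key 0 with ⟨q₀, Y₀, A₀, e₀⟩ | ⟨q₀, Ψ₀, e₀⟩ <;>
    rcases key 1 with ⟨q₁, Y₁, A₁, e₁⟩ | ⟨q₁, Ψ₁, e₁⟩ <;>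
    rcases key 2 with ⟨q₂, Y₂, A₂, e₂⟩ | ⟨q₂, Ψ₂, e₂⟩ <;>
    rcases key 3 with ⟨q₃, Y₃, A₃, e₃⟩ | ⟨q₃, Ψ₃, e₃⟩ <;>
    rcases key 4 with ⟨q₄, Y₄, A₄, e₄⟩ | ⟨q₄, Ψ₄, e₄⟩ <;>
    simp only [q₀, q₁, q₂, q₃, q₄, e₀, e₁, e₂, e₃, e₄, mul_zero, mul_one, sgn_zero, sgn_one,
      sisoBracket_even_even, sisoBracket_even_odd, sisoBracket_odd_even, sisoBracket_odd_odd, hcons,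
      bi_zero₁, bi_zero₂, bi_zero₃, bi_zero₄, bi_sub₃, bi_neg₁, sub_zero, add_zero, zero_add,
      zero_sub, sub_self]
  · have h := bi_invariant Y₀ Ψ₃ Ψ₄ A₁ A₂
    have h' := bi_invariant Y₁ Ψ₃ Ψ₄ A₀ A₂
    have h'' := bi_invariant Y₂ Ψ₃ Ψ₄ A₀ A₁
    linarith
  · have h := bi_invariant Y₀ Ψ₂ Ψ₄ A₁ A₃
    have h' := bi_invariant Y₁ Ψ₂ Ψ₄ A₀ A₃
    have h'' := bi_invariant Y₃ Ψ₂ Ψ₄ A₀ A₁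
    linarith
  · have h := bi_invariant Y₀ Ψ₂ Ψ₃ A₁ A₄
    have h' := bi_invariant Y₁ Ψ₂ Ψ₃ A₀ A₄
    have h'' := bi_invariant Y₄ Ψ₂ Ψ₃ A₀ A₁
    linarith
  · have h := bi_invariant Y₀ Ψ₁ Ψ₄ A₂ A₃
    have h' := bi_invariant Y₂ Ψ₁ Ψ₄ A₀ A₃
    have h'' := bi_invariant Y₃ Ψ₁ Ψ₄ A₀ A₂
    linarith
  · have h := bi_invariant Y₀ Ψ₁ Ψ₃ A₂ A₄
    have h' := bi_invariant Y₂ Ψ₁ Ψ₃ A₀ A₄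
    have h'' := bi_invariant Y₄ Ψ₁ Ψ₃ A₀ A₂
    linarith
  · have h := bi_invariant Y₀ Ψ₁ Ψ₂ A₃ A₄
    have h' := bi_invariant Y₃ Ψ₁ Ψ₂ A₀ A₄
    have h'' := bi_invariant Y₄ Ψ₁ Ψ₂ A₀ A₃
    linarith
  -- Four spinors and one even entry: the terms in which the Lorentz part acts contain four spinors
  -- and drop out, leaving only brackets of two spinors.
  · have h := bi_dot_sum Ψ₁ Ψ₂ Ψ₃ Ψ₄ A₀
    linarith
  · have h := bi_invariant Y₁ Ψ₀ Ψ₄ A₂ A₃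
    have h' := bi_invariant Y₂ Ψ₀ Ψ₄ A₁ A₃
    have h'' := bi_invariant Y₃ Ψ₀ Ψ₄ A₁ A₂
    linarith
  · have h := bi_invariant Y₁ Ψ₀ Ψ₃ A₂ A₄
    have h' := bi_invariant Y₂ Ψ₀ Ψ₃ A₁ A₄
    have h'' := bi_invariant Y₄ Ψ₀ Ψ₃ A₁ A₂
    linarith
  · have h := bi_invariant Y₁ Ψ₀ Ψ₂ A₃ A₄
    have h' := bi_invariant Y₃ Ψ₀ Ψ₂ A₁ A₄
    have h'' := bi_invariant Y₄ Ψ₀ Ψ₂ A₁ A₃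
    linarith
  · have h := bi_dot_sum Ψ₀ Ψ₂ Ψ₃ Ψ₄ A₁
    linarith
  · have h := bi_invariant Y₂ Ψ₀ Ψ₁ A₃ A₄
    have h' := bi_invariant Y₃ Ψ₀ Ψ₁ A₂ A₄
    have h'' := bi_invariant Y₄ Ψ₀ Ψ₁ A₂ A₃
    linarith
  · have h := bi_dot_sum Ψ₀ Ψ₁ Ψ₃ Ψ₄ A₂
    linarith
  · have h := bi_dot_sum Ψ₀ Ψ₁ Ψ₂ Ψ₄ A₃
    linarith
  · have h := bi_dot_sum Ψ₀ Ψ₁ Ψ₂ Ψ₃ A₄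
    linarith

end Cocycle

/-! ### Nontriviality of β, signature and dimensions -/

section Main

variable {K : Type} [NormedDivisionAlgebra K]

theorem betaSiso_isEvenCocycle : IsEvenCocycle (sisoGrading K) (evenGrading ℝ)
    (fun x y => sisoBracket K x y) (fun _ _ => 0) (betaSiso K) :=
  ⟨betaSiso_isCochain, fun q X hX => by
    rw [coboundary_four, betaSiso_pairSum q X hX, neg_zero]⟩

theorem ip_one_one : ip (1 : K) 1 = 1 := by
  rw [ip_one_right, NormedDivisionAlgebra.re_one]

/-- The two spinors have zero product with each other, and vectors commute with everything in `T`.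
The two vectors chosen are orthogonal, so their gammas anticommute and the commutator is twice the
product. -/
theorem betaSiso_not_isCoboundary : ¬ IsCoboundary (sisoGrading K) (evenGrading ℝ)
    (fun x y => sisoBracket K x y) (fun _ _ => 0) (betaSiso K) := by
  set Ψ : Spinor K := Sum.elim ![1, 0] ![0, 0] with hΨ
  set Φ : Spinor K := Sum.elim ![0, 0] ![0, 1] with hΦ
  have hdot : dot K Ψ Φ = 0 := ext_minkowski fun A => by
    obtain ⟨a, p, s, y, rfl⟩ := exists_vec A
    rw [minkowski_dot, pairing_eq, gamma_vec, hΨ, hΦ]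
    simp
  have hbi : bi Ψ Φ (vec 0 1 (-1) 0) (vec 0 0 0 1) = -2 := by
    rw [bi_eq, pairing_eq, pairing_eq]
    simp [gamma_vec, hΨ, hΦ, ip_one_one]
    norm_num
  refine not_isCoboundary_of_commuting ![1, 1, 0, 0]
    ![(0, 0, Ψ), (0, 0, Φ), (0, vec 0 1 (-1) 0, 0), (0, vec 0 0 0 1, 0)] ?_ ?_ ?_
  · intro i
    fin_cases i
    · exact odd_mem _
    · exact odd_mem _
    · exact even_mem _ _
    · exact even_mem _ _
  -- Only distinct entries are bracketed, so it does not matter that Ψ·Ψ is nonzero.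
  · intro i j hij
    fin_cases i <;> fin_cases j <;> first
      | exact absurd hij (by decide)
      | simp [sisoBracket_apply, hdot]
  · rw [betaSiso_eq]
    simp [bi_zero₃, hbi]

/-! ## The signature of spacetime -/

theorem exists_orthonormal_basis : ∃ f : Module.Basis (Fin (Module.finrank ℝ K)) ℝ K,
    ∀ i j, ip (f i) (f j) = if i = j then 1 else 0 := by
  have hsymm : (ip : LinearMap.BilinForm ℝ K).IsSymm := ⟨fun a b => ip_comm a b⟩
  obtain ⟨v, hv⟩ := LinearMap.BilinForm.exists_orthogonal_basis hsymm
  have hpos : ∀ i, 0 < ip (v i) (v i) := fun i => ip_self_pos (v.ne_zero i)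
  refine ⟨v.isUnitSMul (w := fun i => (Real.sqrt (ip (v i) (v i)))⁻¹) fun i =>
    (inv_ne_zero (Real.sqrt_pos.mpr (hpos i)).ne').isUnit, fun i j => ?_⟩
  rw [Module.Basis.isUnitSMul_apply, Module.Basis.isUnitSMul_apply, map_smul, LinearMap.map_smul₂,
    smul_eq_mul, smul_eq_mul]
  split_ifs with h
  · subst h
    have h₁ := Real.mul_self_sqrt (hpos i).le
    have h₂ := (Real.sqrt_pos.mpr (hpos i)).ne'
    rw [← mul_assoc, ← mul_inv, h₁, inv_mul_cancel₀ (hpos i).ne']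
  · have := hv h
    rw [show ip (v i) (v j) = 0 from this, mul_zero, mul_zero]

/-- The off-diagonal vectors, as a linear map. -/
noncomputable def offDiagonal : K →ₗ[ℝ] Vec K where
  toFun y := vec 0 0 0 y
  map_add' y y' := by rw [vec_add]; simp
  map_smul' r y := by rw [RingHom.id_apply, vec_smul]; simp

theorem exists_minkowski_basis {n : ℕ} (f : Module.Basis (Fin n) ℝ K)
    (hf : ∀ i j, ip (f i) (f j) = if i = j then 1 else 0) :
    ∃ e : Module.Basis (Fin (n + 3)) ℝ (Vec K), ∀ i j,
      minkowski K (e i) (e j) = if i = j then (if i = 0 then -1 else 1) else 0 := by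
  -- In the variables `p`, `s` the metric is `-p * s`; it is diagonalized by `(1, 1)`, which is
  -- timelike, and `(1, -1)`, which is spacelike.
  set e : Fin (n + 3) → Vec K := Fin.cons (vec 0 1 1 0) (Fin.cons (vec 0 1 (-1) 0)
    (Fin.cons (vec 1 0 0 0) fun i => vec 0 0 0 (f i))) with he
  have hz : ∀ (m : ℕ) (j : Fin m), (0 = j.succ) = False := fun m j =>
    eq_false (Fin.succ_ne_zero j).symm
  have hgram : ∀ i j, minkowski K (e i) (e j) =
      if i = j then (if i = 0 then -1 else 1) else 0 := by
    intro i j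
    refine Fin.cases ?_ (fun i => Fin.cases ?_ (fun i => Fin.cases ?_ (fun i => ?_) i) i) i <;>
      refine Fin.cases ?_ (fun j => Fin.cases ?_ (fun j => Fin.cases ?_ (fun j => ?_) j) j) j <;>
      simp only [he, Fin.cons_zero, Fin.cons_succ, minkowski_vec, hf, Fin.succ_inj,
        Fin.succ_ne_zero, hz, if_true, if_false, map_zero, LinearMap.zero_apply] <;>
      norm_num
  -- Orthogonal vectors of nonzero square are independent, even for an indefinite form.
  have hli : LinearIndependent ℝ e := by
    refine LinearMap.BilinForm.linearIndependent_of_iIsOrtho (B := minkowski K) ?_ ?_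
    · intro i j hij
      exact (hgram i j).trans (if_neg hij)
    · intro i hi
      have h : minkowski K (e i) (e i) = 0 := hi
      rw [hgram, if_pos rfl] at h
      split_ifs at h <;> norm_num at h
  have hsp : ⊤ ≤ Submodule.span ℝ (Set.range e) := by
    intro M _
    obtain ⟨a, p, s, y, rfl⟩ := exists_vec M
    have hmem : ∀ i, e i ∈ Submodule.span ℝ (Set.range e) := fun i =>
      Submodule.subset_span ⟨i, rfl⟩
    have hy : vec 0 0 0 y ∈ Submodule.span ℝ (Set.range e) := by
      have h := congrArg offDiagonal (f.sum_repr y)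
      rw [map_sum] at h
      change _ = vec 0 0 0 y at h
      rw [← h]
      refine Submodule.sum_mem _ fun i _ => ?_
      rw [map_smul]
      exact Submodule.smul_mem _ _ (hmem i.succ.succ.succ)
    have hM : vec a p s y = ((p + s) / 2) • e 0 + ((p - s) / 2) • e (Fin.succ 0) +
        a • e (Fin.succ (Fin.succ 0)) + vec 0 0 0 y := by
      simp only [he, Fin.cons_zero, Fin.cons_succ, vec_smul, vec_add]
      congr 1 <;> simp <;> ring
    rw [hM]
    exact add_mem (add_mem (add_mem (Submodule.smul_mem _ _ (hmem _))
      (Submodule.smul_mem _ _ (hmem _))) (Submodule.smul_mem _ _ (hmem _))) hy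
  refine ⟨Module.Basis.mk hli hsp, fun i j => ?_⟩
  rw [Module.Basis.mk_apply, Module.Basis.mk_apply, hgram]

theorem finrank_carrier (k : DivAlg) : Module.finrank ℝ k.carrier = k.dim := by
  cases k
  · exact Module.finrank_self ℝ
  · exact Complex.finrank_real_complex
  · exact Quaternion.finrank_eq_four
  · exact (Module.finrank_prod (R := ℝ) (M := ℍ[ℝ]) (M' := ℍ[ℝ])).trans (by
      rw [Quaternion.finrank_eq_four]
      rfl)

end Main
end Brane

open Brane
/-- Let `K` be `ℝ`, `ℂ`, `ℍ` or `𝕆`, of dimension `n`. -/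
theorem mainTheorem1 (k : DivAlg) :
    -- the vectors form a Minkowski spacetime of dimension `n + 3 = 4, 5, 7, 11`
    (∃ e : Module.Basis (Fin (k.dim + 3)) ℝ (Vec k.carrier), ∀ i j,
      minkowski k.carrier (e i) (e j) = if i = j then (if i = 0 then -1 else 1) else 0) ∧
    -- the Poincaré superalgebra is a Lie superalgebra
    IsLieSuperalgebra (sisoGrading k.carrier) (sisoBracket k.carrier) ∧
    -- `β` is an even 4-cocycle on it with values in the trivial representation, and nontrivial
    IsEvenCocycle (sisoGrading k.carrier) (evenGrading ℝ) (fun x y => sisoBracket k.carrier x y)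
      (fun _ _ => 0) (betaSiso k.carrier) ∧
    ¬ IsCoboundary (sisoGrading k.carrier) (evenGrading ℝ) (fun x y => sisoBracket k.carrier x y)
      (fun _ _ => 0) (betaSiso k.carrier) ∧
    -- the extension by `β` is a nonexact Lie 3-superalgebra
    LInftyData.IsLieNSuperalgebra 3 (twoBrane k.carrier) ∧
    ¬ LInftyData.IsExact 2 (twoBrane k.carrier) ∧
    -- it is an extension of the Poincaré superalgebra by `b²ℝ`
    LInftyData.IsShortExact LInftyData.bTwoR (twoBrane k.carrier)
      (LInftyData.ofLie (sisoGrading k.carrier) (sisoBracket k.carrier))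
      (LinearMap.inr ℝ (Siso k.carrier) ℝ) (LinearMap.fst ℝ (Siso k.carrier) ℝ) := by
  refine ⟨?_, siso_isLieSuperalgebra, betaSiso_isEvenCocycle, betaSiso_not_isCoboundary,
    LInftyData.extension_isLieNSuperalgebra siso_isLieSuperalgebra betaSiso_isEvenCocycle,
    fun h => betaSiso_not_isCoboundary (LInftyData.isCoboundary_of_isExact h),
    LInftyData.extension_isShortExact siso_isLieSuperalgebra betaSiso_isEvenCocycle⟩
  obtain ⟨f, hf⟩ := exists_orthonormal_basis (K := k.carrier)
  have h := exists_minkowski_basis f hf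
  -- Only here do the four concrete algebras enter, through their dimensions.
  rwa [finrank_carrier] at h
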